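/- **Setting.** On $\mathbb R^{1+3}$ with the metric $x\cdot x=x_0^2-x_1^2-x_2^2-x_3^2$, let $\mathcal P_+^\uparrow=\mathbb R^{4}\rtimes\mathcal L_+^\uparrow$ be the proper orthochronous Poincaré group, where $\mathcal L_+^\uparrow$ is the identity component of the Lorentz group. A wedge is a region $W=gW_1$ with $g\in\mathcal P_+^\uparrow$ and $W_1=\{x:|x_0|<x_1\}$; $\mathcal W$ is the set of wedges. The causal complement $W'$ of a wedge $W$ is the interior of the set of points spacelike separated from every point of $W$; it is again a wedge. Let $\Lambda_{W_1}(t)$ be the boosts $(x_0,x_1)\mapsto(\cosh t\,x_0+\sinh t\,x_1,\ \sinh t\,x_0+\cosh t\,x_1)$, with $x_2,x_3$ fixed, and put $\Lambda_W(t)=g\Lambda_{W_1}(t)g^{-1}$ for $W=gW_1$ (this does not depend on the choice of $g$). Let $\mathcal H$ be a complex Hilbert space. For a closed real linear subspace $K\subset\mathcal H$ let $K'=\{x\in\mathcal H:\operatorname{Im}\langle y,x\rangle=0\ \ \forall y\in K\}$; $K$ is cyclic if $K+iK$ is dense, separating if $K\cap iK=\{0\}$, and standard if it is both. For a standard subspace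 $K$ let $S_K$ be the closure of the antilinear operator $\xi+i\eta\mapsto\xi-i\eta$ ($\xi,\eta\in K$), and let $\Delta_K=S_K^*S_K$, a positive self-adjoint injective operator, so that the unitaries $\Delta_K^{it}$, $t\in\mathbb R$, are defined by the functional calculus. Let $U$ be a strongly continuous unitary representation of $\mathcal P_+^\uparrow$ on $\mathcal H$ with positive energy (for every $a$ in the closed forward light cone, the self-adjoint generator $P_a$ in $U(sa)=e^{isP_a}$, $s\in\mathbb R$, is positive). Let $H$ be a map that assigns to every $W\in\mathcal W$ a closed real linear subspace $H(W)\subset\mathcal H$ such that 1. (isotony) $H(V_1)\subset H(V_2)$ whenever $V_1\subset V_2$ are wedges; 2. (covariance) $U(g)H(V)=H(gV)$ for all $V\in\mathcal W$ and $g\in\mathcal P_+^\uparrow$; 3. (Reeh–Schlieder) $H(V)$ is cyclic for every $V\in\mathcal W$; 4. (locality) $H(V_1)\subset H(V_2)'$ whenever $V_1,V_2$ are wedges with $V_1\subset V_2'$. Then every $H(V)$ is standard. **Theorem.** Let $(U,H)$ be as above, let $W\in\mathcal W$, and let $r_W\in\mathcal P_+^\uparrow$ satisfy $r_WW=W'$.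 Suppose that $$Z_{H(W)}(t)=\Delta_{H(W)}^{it}\,U(\Lambda_W(2\pi t))$$ commutes with $U(r_W)$ for every $t\in\mathbb R$. Then the Bisognano–Wichmann property $$U(\Lambda_V(2\pi t))=\Delta_{H(V)}^{-it}\qquad\text{for all }V\in\mathcal W,\ t\in\mathbb R,$$ and wedge duality $$H(V)=H(V')'\qquad\text{for all }V\in\mathcal W$$ both hold. -/

import Mathlib

noncomputable section ModularTheory

namespace StandardSubspace

open Complex ClosedSubmodule
open scoped ComplexOrder ComplexInnerProductSpace InnerProduct

variable {H : Type*} [NormedAddCommGroup H] [InnerProductSpace ℂ H]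

/-- The graph `{(ξ + iη, ξ - iη) | ξ, η ∈ K}`. -/
def tomitaGraph (K : StandardSubspace H) : Submodule ℝ (H × H) where
  carrier := {p | ∃ ξ ∈ K.toClosedSubmodule, ∃ η ∈ K.toClosedSubmodule,
    p = (ξ + I • η, ξ - I • η)}
  add_mem' := by
    rintro _ _ ⟨ξ, hξ, η, hη, rfl⟩ ⟨ξ', hξ', η', hη', rfl⟩
    refine ⟨ξ + ξ', add_mem hξ hξ', η + η', add_mem hη hη', ?_⟩
    ext <;> simp only [Prod.mk_add_mk, smul_add] <;> abel
  zero_mem' := ⟨0, zero_mem _, 0, zero_mem _, by simp [Prod.ext_iff]⟩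
  smul_mem' := by
    rintro c _ ⟨ξ, hξ, η, hη, rfl⟩
    refine ⟨c • ξ, SMulMemClass.smul_mem c hξ, c • η, SMulMemClass.smul_mem c hη, ?_⟩
    ext <;> simp [smul_add, smul_sub, smul_comm I c η]

theorem mem_tomitaGraph {K : StandardSubspace H} {p : H × H} :
    p ∈ K.tomitaGraph ↔
      p.1 + p.2 ∈ K.toClosedSubmodule ∧ I • (p.1 - p.2) ∈ K.toClosedSubmodule := by
  constructor
  · rintro ⟨ξ, hξ, η, hη, rfl⟩
    refine ⟨?_, ?_⟩
    · have : ξ + I • η + (ξ - I • η) = (2 : ℝ) • ξ := by rw [two_smul]; abel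
      rw [this]; exact SMulMemClass.smul_mem _ hξ
    · have : I • (ξ + I • η - (ξ - I • η)) = (-2 : ℝ) • η := by
        have : ξ + I • η - (ξ - I • η) = I • η + I • η := by abel
        rw [this, smul_add, smul_smul, I_mul_I, neg_smul, neg_smul, one_smul, two_smul]; abel
      rw [this]; exact SMulMemClass.smul_mem _ hη
  · rintro ⟨h1, h2⟩
    refine ⟨(1 / 2 : ℝ) • (p.1 + p.2), SMulMemClass.smul_mem _ h1,
      (-(1 / 2) : ℝ) • (I • (p.1 - p.2)), SMulMemClass.smul_mem _ h2, ?_⟩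
    have e : I • (-(1 / 2) : ℝ) • (I • (p.1 - p.2)) = (1 / 2 : ℝ) • (p.1 - p.2) := by
      rw [smul_comm I, smul_smul I I, I_mul_I, neg_one_smul, neg_smul, smul_neg, neg_neg]
    rw [e]
    ext
    · have : p.1 = (1 / 2 : ℝ) • (p.1 + p.1) := by rw [← two_smul ℝ p.1, smul_smul]; simp
      change p.1 = _
      rw [← smul_add]; convert this using 2; abel
    · have : p.2 = (1 / 2 : ℝ) • (p.2 + p.2) := by rw [← two_smul ℝ p.2, smul_smul]; simp
      change p.2 = _
      rw [← smul_sub]; convert this using 2; abel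

theorem tomitaGraph_isClosed (K : StandardSubspace H) :
    IsClosed (K.tomitaGraph : Set (H × H)) := by
  have hK : IsClosed (K.toClosedSubmodule : Set H) := K.toClosedSubmodule.isClosed'
  have : (K.tomitaGraph : Set (H × H)) =
      (fun p : H × H => p.1 + p.2) ⁻¹' (K.toClosedSubmodule : Set H) ∩
      (fun p : H × H => I • (p.1 - p.2)) ⁻¹' (K.toClosedSubmodule : Set H) := by
    ext p; exact mem_tomitaGraph
  rw [this]
  exact (hK.preimage (by fun_prop)).inter (hK.preimage (by fun_prop))

theorem tomitaGraph_snd_eq_zero (K : StandardSubspace H) :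
    ∀ p ∈ K.tomitaGraph, p.1 = 0 → p.2 = 0 := by
  intro p hp h0
  obtain ⟨h1, h2⟩ := mem_tomitaGraph.1 hp
  rw [h0, zero_add] at h1
  rw [h0, zero_sub, smul_neg] at h2
  have : p.2 ∈ K.toClosedSubmodule ⊓ K.toClosedSubmodule.mulI := by
    refine ⟨h1, ?_⟩
    change p.2 ∈ K.toClosedSubmodule.mulI
    rw [mem_mapEquiv_iff, scalarSMulCLE_symm_apply]
    simpa [Units.smul_def] using h2
  rw [K.IsSeparating] at this
  simpa using this

/-- The involution `ξ + iη ↦ ξ - iη` on `K + iK`, as a real linear operator. -/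
def tomitaCore (K : StandardSubspace H) : H →ₗ.[ℝ] H := K.tomitaGraph.toLinearPMap

/-- The Tomita operator `S_K`. It is antilinear; here it is recorded as a real linear operator. -/
def tomita (K : StandardSubspace H) : H →ₗ.[ℝ] H := K.tomitaCore.closure

theorem tomita_graph (K : StandardSubspace H) : K.tomita.graph = K.tomitaGraph := by
  have hg : K.tomitaCore.graph = K.tomitaGraph :=
    Submodule.toLinearPMap_graph_eq _ K.tomitaGraph_snd_eq_zero
  have hc : K.tomitaCore.IsClosed := by
    rw [LinearPMap.IsClosed, hg]; exact K.tomitaGraph_isClosed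
  rw [tomita, ← hc.isClosable.graph_closure_eq_closure_graph, hg]
  exact K.tomitaGraph_isClosed.submodule_topologicalClosure_eq

theorem tomita_smul {K : StandardSubspace H} {x y : H} (c : ℂ)
    (h : (x, y) ∈ K.tomita.graph) : (c • x, (starRingEnd ℂ) c • y) ∈ K.tomita.graph := by
  rw [tomita_graph, mem_tomitaGraph] at h ⊢
  obtain ⟨h1, h2⟩ := h
  dsimp only at h1 h2 ⊢
  have e1 : c • x + (starRingEnd ℂ) c • y = c.re • (x + y) + c.im • (I • (x - y)) := by
    conv_lhs => rw [← Complex.re_add_im c]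
    simp only [map_add, map_mul, conj_ofReal, conj_I, ← Complex.coe_smul]
    module
  have e2 : I • (c • x - (starRingEnd ℂ) c • y) = c.re • (I • (x - y)) + (-c.im) • (x + y) := by
    conv_lhs => rw [← Complex.re_add_im c]
    simp only [map_add, map_mul, conj_ofReal, conj_I, ← Complex.coe_smul, ofReal_neg]
    have hI : I ^ 2 = -1 := I_sq
    rw [smul_sub, smul_smul, smul_smul, mul_add, mul_add]
    have e3 : I * (c.im * I) = -(c.im : ℂ) := by linear_combination (c.im : ℂ) * hI
    have e4 : I * (c.im * -I) = (c.im : ℂ) := by linear_combination -(c.im : ℂ) * hI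
    rw [e3, e4]
    module
  rw [e1, e2]
  exact ⟨add_mem (SMulMemClass.smul_mem _ h1) (SMulMemClass.smul_mem _ h2),
    add_mem (SMulMemClass.smul_mem _ h2) (SMulMemClass.smul_mem _ h1)⟩

theorem tomita_domain_dense (K : StandardSubspace H) : Dense (K.tomita.domain : Set H) := by
  have hmem : ∀ x ∈ K.toClosedSubmodule.toSubmodule ⊔ K.toClosedSubmodule.mulI.toSubmodule,
      x ∈ K.tomita.domain := by
    intro x hx
    obtain ⟨ξ, hξ, η, hη, rfl⟩ := Submodule.mem_sup.1 hx
    have hη' : η ∈ K.toClosedSubmodule.mulI := hη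
    rw [mem_mapEquiv_iff, scalarSMulCLE_symm_apply] at hη'
    have : (ξ + η, ξ - η) ∈ K.tomita.graph := by
      rw [tomita_graph]
      refine ⟨ξ, hξ, _, hη', ?_⟩
      simp [Units.smul_def, smul_smul]
    exact LinearPMap.mem_domain_of_mem_graph this
  have h : (K.toClosedSubmodule ⊔ K.toClosedSubmodule.mulI : ClosedSubmodule ℝ H) = ⊤ := K.IsCyclic
  intro x
  have hx : x ∈ (K.toClosedSubmodule ⊔ K.toClosedSubmodule.mulI : ClosedSubmodule ℝ H) := by
    rw [h]; trivial
  exact closure_mono hmem hx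

variable [CompleteSpace H]

theorem mem_tomita_adjoint_graph {K : StandardSubspace H} {y z : H} :
    (y, z) ∈ K.tomita.adjoint.graph ↔
      ∀ a b, (a, b) ∈ K.tomita.graph → inner ℝ b y = inner ℝ a z := by
  rw [LinearPMap.adjoint_graph_eq_graph_adjoint K.tomita_domain_dense, Submodule.mem_adjoint_iff]
  simp only [sub_eq_zero]

theorem tomita_adjoint_smul {K : StandardSubspace H} {y z : H} (c : ℂ)
    (h : (y, z) ∈ K.tomita.adjoint.graph) :
    ((starRingEnd ℂ) c • y, c • z) ∈ K.tomita.adjoint.graph := by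
  rw [mem_tomita_adjoint_graph] at h ⊢
  intro a b hab
  have := h _ _ (tomita_smul ((starRingEnd ℂ) c) hab)
  simpa [inner_real_eq_re_inner, inner_smul_left, inner_smul_right, mul_comm] using this

/-- The graph of `S_K^* S_K`. -/
def modularGraph (K : StandardSubspace H) : Submodule ℂ (H × H) where
  carrier := {p | ∃ y, (p.1, y) ∈ K.tomita.graph ∧ (y, p.2) ∈ K.tomita.adjoint.graph}
  add_mem' := by
    rintro _ _ ⟨y, h1, h2⟩ ⟨y', h1', h2'⟩
    exact ⟨y + y', add_mem h1 h1', add_mem h2 h2'⟩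
  zero_mem' := ⟨0, zero_mem _, zero_mem _⟩
  smul_mem' := by
    rintro c _ ⟨y, h1, h2⟩
    exact ⟨(starRingEnd ℂ) c • y, tomita_smul c h1, tomita_adjoint_smul c h2⟩

/-- The modular operator `Δ_K = S_K^* S_K`, an unbounded complex linear operator. -/
def modularOperator (K : StandardSubspace H) : H →ₗ.[ℂ] H := K.modularGraph.toLinearPMap

theorem modularOperator_graph (K : StandardSubspace H) :
    K.modularOperator.graph = K.modularGraph := by
  refine Submodule.toLinearPMap_graph_eq _ ?_
  rintro ⟨x, z⟩ ⟨y, h1, h2⟩ (rfl : x = 0)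
  have hy : y = 0 := LinearPMap.graph_fst_eq_zero_snd _ h1 rfl
  exact LinearPMap.graph_fst_eq_zero_snd _ h2 hy

theorem exists_tomita_of_modular {K : StandardSubspace H} {x z : H}
    (h : (x, z) ∈ K.modularOperator.graph) :
    ∃ y, (x, y) ∈ K.tomita.graph ∧ ∀ x' y', (x', y') ∈ K.tomita.graph →
      inner ℝ y' y = inner ℝ x' z := by
  rw [modularOperator_graph] at h
  obtain ⟨y, h1, h2⟩ := h
  exact ⟨y, h1, fun x' y' h' => mem_tomita_adjoint_graph.1 h2 _ _ h'⟩

theorem modular_re_inner_nonneg {K : StandardSubspace H} {x z : H}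
    (h : (x, z) ∈ K.modularOperator.graph) : 0 ≤ inner ℝ x z := by
  obtain ⟨y, h1, h2⟩ := exists_tomita_of_modular h
  rw [← h2 _ _ h1]
  exact real_inner_self_nonneg

theorem modular_symm {K : StandardSubspace H} {x z x' z' : H}
    (h : (x, z) ∈ K.modularOperator.graph) (h' : (x', z') ∈ K.modularOperator.graph) :
    inner ℝ x z' = inner ℝ z x' := by
  obtain ⟨y, h1, h2⟩ := exists_tomita_of_modular h
  obtain ⟨y', h1', h2'⟩ := exists_tomita_of_modular h'
  rw [← h2' _ _ h1, real_inner_comm x' z, ← h2 _ _ h1', real_inner_comm]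

theorem modular_injective {K : StandardSubspace H} {x : H}
    (h : (x, 0) ∈ K.modularOperator.graph) : x = 0 := by
  obtain ⟨y, h1, h2⟩ := exists_tomita_of_modular h
  have hy : y = 0 := by simpa using h2 _ _ h1
  subst hy
  rw [tomita_graph, mem_tomitaGraph] at h1
  have : (0, x) ∈ K.tomitaGraph := by
    rw [mem_tomitaGraph]
    refine ⟨by simpa using h1.1, ?_⟩
    have h5 : I • x ∈ K.toClosedSubmodule := by simpa using h1.2
    have h6 : (-1 : ℝ) • I • x ∈ K.toClosedSubmodule := SMulMemClass.smul_mem _ h5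
    simpa using h6
  exact K.tomitaGraph_snd_eq_zero _ this rfl

theorem exists_resolvent_apply (K : StandardSubspace H) (x : H) :
    ∃! y, (y, x - y) ∈ K.modularOperator.graph := by
  refine existsUnique_of_exists_of_unique ?_ ?_
  · let G : Submodule ℝ (WithLp 2 (H × H)) :=
      K.tomitaGraph.comap (WithLp.linearEquiv 2 ℝ (H × H)).toLinearMap
    have hG : IsClosed (G : Set (WithLp 2 (H × H))) :=
      K.tomitaGraph_isClosed.preimage (WithLp.prod_continuous_ofLp 2 H H)
    have : CompleteSpace G := hG.completeSpace_coe
    obtain ⟨p, hp, q, hq, hpq⟩ := G.exists_add_mem_mem_orthogonal (WithLp.toLp 2 (x, 0))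
    have hpG : (p.fst, p.snd) ∈ K.tomitaGraph := hp
    have e1 : q.fst = x - p.fst := by
      have := congrArg WithLp.fst hpq; simp at this; rw [this]; abel
    have e2 : q.snd = - p.snd := by
      have := congrArg WithLp.snd hpq; simp at this
      exact (neg_eq_of_add_eq_zero_right this.symm).symm
    refine ⟨p.fst, ?_⟩
    rw [modularOperator_graph]
    refine ⟨p.snd, by rw [tomita_graph]; exact hpG, ?_⟩
    rw [mem_tomita_adjoint_graph]
    intro a b hab
    rw [tomita_graph] at hab
    have := (Submodule.mem_orthogonal _ _).1 hq (WithLp.toLp 2 (a, b)) hab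
    rw [WithLp.prod_inner_apply] at this
    simp only [WithLp.ofLp_fst, WithLp.ofLp_snd, e1, e2] at this
    simp only [inner_neg_right] at this
    change inner ℝ b p.snd = inner ℝ a (x - p.fst)
    linarith
  · intro y y' h h'
    have h0 : (y - y', -(y - y')) ∈ K.modularOperator.graph := by
      have := sub_mem h h'
      simpa using this
    have := modular_re_inner_nonneg h0
    rw [inner_neg_right, real_inner_self_eq_norm_sq] at this
    have h2 : ‖y - y'‖ = 0 := by nlinarith [norm_nonneg (y - y')]
    exact sub_eq_zero.1 (norm_eq_zero.1 h2)

theorem exists_resolvent (K : StandardSubspace H) :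
    ∃ B : H →L[ℂ] H, ∀ x y, B x = y ↔ (y, x - y) ∈ K.modularOperator.graph := by
  choose R hR hu using K.exists_resolvent_apply
  refine ⟨LinearMap.mkContinuous
    { toFun := R
      map_add' := fun x x' => ?_
      map_smul' := fun c x => ?_ } 1 ?_, fun x y => ⟨?_, fun h => (hu x y h).symm⟩⟩
  · refine (hu _ _ ?_).symm
    have := add_mem (hR x) (hR x')
    simp only [Prod.mk_add_mk] at this
    convert this using 2; abel
  · refine (hu _ _ ?_).symm
    have := Submodule.smul_mem _ c (hR x)
    simpa [smul_sub] using this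
  · intro x
    have := modular_re_inner_nonneg (hR x)
    rw [inner_sub_right, real_inner_self_eq_norm_sq] at this
    have h2 := real_inner_le_norm (R x) x
    change ‖R x‖ ≤ 1 * ‖x‖
    by_contra! hlt
    nlinarith [norm_nonneg (R x), norm_nonneg x]
  · rintro rfl; exact hR x

/-- The bounded operator `(1 + Δ_K)⁻¹`. -/
def modularResolvent (K : StandardSubspace H) : H →L[ℂ] H := K.exists_resolvent.choose

theorem modularResolvent_eq_iff (K : StandardSubspace H) (x y : H) :
    K.modularResolvent x = y ↔ (y, x - y) ∈ K.modularOperator.graph :=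
  K.exists_resolvent.choose_spec x y

/-- `f(Δ_K)` for `f` continuous with compact support in `(0, ∞)`: if `B = (1 + Δ_K)⁻¹` then
`Δ_K = B⁻¹ - 1`, so `f(Δ_K)` is the function `b ↦ f (b⁻¹ - 1)` of the bounded self-adjoint
operator `B`. -/
def modularFunction (K : StandardSubspace H) (f : ℝ → ℂ) : H →L[ℂ] H :=
  cfc (fun z : ℂ => f (z.re⁻¹ - 1)) K.modularResolvent

theorem modularResolvent_mem (K : StandardSubspace H) (x : H) :
    (K.modularResolvent x, x - K.modularResolvent x) ∈ K.modularOperator.graph :=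
  (K.modularResolvent_eq_iff x _).1 rfl

theorem modularResolvent_isPositive (K : StandardSubspace H) :
    K.modularResolvent.IsPositive := by
  have hre : ∀ x x' : H, (⟪K.modularResolvent x, x'⟫).re = (⟪x, K.modularResolvent x'⟫).re := by
    intro x x'
    have := modular_symm (K.modularResolvent_mem x) (K.modularResolvent_mem x')
    simp only [inner_real_eq_re_inner, inner_sub_left, inner_sub_right] at this
    linarith
  rw [ContinuousLinearMap.isPositive_def']
  refine ⟨?_, fun x => ?_⟩
  · rw [ContinuousLinearMap.isSelfAdjoint_iff_isSymmetric]
    intro x x'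
    apply Complex.ext
    · exact hre x x'
    · have := hre x (I • x')
      simpa [inner_smul_right] using this
  · have := modular_re_inner_nonneg (K.modularResolvent_mem x)
    rw [inner_sub_right, real_inner_self_eq_norm_sq, inner_real_eq_re_inner] at this
    change 0 ≤ (⟪K.modularResolvent x, x⟫).re
    nlinarith [norm_nonneg (K.modularResolvent x)]

theorem modularResolvent_compl_isPositive (K : StandardSubspace H) :
    (1 - K.modularResolvent).IsPositive := by
  rw [ContinuousLinearMap.isPositive_def']
  refine ⟨(IsSelfAdjoint.one _).sub K.modularResolvent_isPositive.isSelfAdjoint, fun x => ?_⟩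
  have := modular_re_inner_nonneg (K.modularResolvent_mem x)
  have h2 : 0 ≤ inner ℝ (x - K.modularResolvent x) (x - K.modularResolvent x) :=
    real_inner_self_nonneg
  rw [inner_sub_left (x := x) (y := K.modularResolvent x)] at h2
  change 0 ≤ (⟪x - K.modularResolvent x, x⟫).re
  have h3 : inner ℝ (x - K.modularResolvent x) x
      = inner ℝ x (x - K.modularResolvent x) := real_inner_comm _ _
  rw [← inner_real_eq_re_inner, h3]
  linarith

theorem modularResolvent_spectrum (K : StandardSubspace H) {z : ℂ}
    (hz : z ∈ spectrum ℂ K.modularResolvent) : z = z.re ∧ z.re ∈ Set.Icc (0 : ℝ) 1 := by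
  have h0 : (0 : H →L[ℂ] H) ≤ K.modularResolvent :=
    (ContinuousLinearMap.nonneg_iff_isPositive _).2 K.modularResolvent_isPositive
  have h1 : (0 : H →L[ℂ] H) ≤ 1 - K.modularResolvent :=
    (ContinuousLinearMap.nonneg_iff_isPositive _).2 K.modularResolvent_compl_isPositive
  refine ⟨K.modularResolvent_isPositive.isSelfAdjoint.mem_spectrum_eq_re hz, ?_, ?_⟩
  · exact (Complex.le_def.1 (spectrum_nonneg_of_nonneg h0 hz)).1
  · have : 1 - z ∈ spectrum ℂ (1 - K.modularResolvent) := by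
      rw [spectrum.mem_iff] at hz ⊢
      intro hu
      apply hz
      convert hu.neg using 1
      simp only [map_sub, map_one]; abel
    have := (Complex.le_def.1 (spectrum_nonneg_of_nonneg h1 this)).1
    simpa using this

/-- Continuous functions on `(0, ∞)` vanishing at `0` and at `∞`, extended by `0` to `ℝ`. -/
structure VanishesAtEnds (f : ℝ → ℂ) : Prop where
  continuous : Continuous f
  eq_zero : ∀ x ≤ 0, f x = 0
  tendsto : Filter.Tendsto f Filter.atTop (nhds 0)

theorem VanishesAtEnds.continuousOn {f : ℝ → ℂ} (hf : VanishesAtEnds f) :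
    ContinuousOn (fun z : ℂ => f (z.re⁻¹ - 1)) {z | 0 ≤ z.re} := by
  have key : ContinuousOn (fun b : ℝ => f (b⁻¹ - 1)) (Set.Ici 0) := by
    intro b hb
    rcases eq_or_lt_of_le (show (0 : ℝ) ≤ b from hb) with rfl | hb
    · rw [← Set.Ioi_insert, continuousWithinAt_insert_self]
      have h0 : f ((0 : ℝ)⁻¹ - 1) = 0 := hf.eq_zero _ (by norm_num)
      rw [ContinuousWithinAt, h0]
      refine hf.tendsto.comp ?_
      exact Filter.tendsto_atTop_add_const_right _ (-1) tendsto_inv_nhdsGT_zero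
    · have : ContinuousAt (fun b : ℝ => b⁻¹ - 1) b := by
        have := hb.ne'
        fun_prop (disch := assumption)
      exact (hf.continuous.continuousAt.comp this).continuousWithinAt
  exact key.comp Complex.continuous_re.continuousOn fun z hz => hz

theorem norm_cpow_I_mul {x : ℝ} (hx : 0 < x) (t : ℝ) : ‖(x : ℂ) ^ (I * t)‖ = 1 := by
  rw [Complex.norm_cpow_eq_rpow_re_of_pos hx]; simp

theorem VanishesAtEnds.cpow_mul {f : ℝ → ℂ} (hf : VanishesAtEnds f) (t : ℝ) :
    VanishesAtEnds fun x : ℝ => (x : ℂ) ^ (I * t) * f x := by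
  have hle : ∀ x : ℝ, ‖(x : ℂ) ^ (I * t) * f x‖ ≤ ‖f x‖ := by
    intro x
    rcases le_or_gt x 0 with hx | hx
    · simp [hf.eq_zero x hx]
    · rw [norm_mul, norm_cpow_I_mul hx, one_mul]
  refine ⟨continuous_iff_continuousAt.2 fun x => ?_, fun x hx => by simp [hf.eq_zero x hx], ?_⟩
  · rcases le_or_gt x 0 with hx | hx
    · have hz := hf.eq_zero x hx
      rw [ContinuousAt, hz, mul_zero]
      refine squeeze_zero_norm hle ?_
      have := hf.continuous.norm.tendsto x
      rwa [hz, norm_zero] at this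
    · refine ContinuousAt.mul ?_ hf.continuous.continuousAt
      exact (Complex.continuous_ofReal.continuousAt).cpow continuousAt_const (Or.inl hx)
  · exact squeeze_zero_norm hle (by simpa using hf.tendsto.norm)

theorem modularFunction_mul (K : StandardSubspace H) {f g : ℝ → ℂ} (hf : VanishesAtEnds f)
    (hg : VanishesAtEnds g) :
    K.modularFunction (fun x => f x * g x) = K.modularFunction f * K.modularFunction g :=
  cfc_mul _ _ _ (hf.continuousOn.mono fun _ hz => (K.modularResolvent_spectrum hz).2.1)
    (hg.continuousOn.mono fun _ hz => (K.modularResolvent_spectrum hz).2.1)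

/-- The function `x / (1 + x)²` on `(0, ∞)`, whose value at `Δ_K` is `B (1 - B)`. -/
def bump (x : ℝ) : ℂ := if x ≤ 0 then 0 else ((x / (1 + x) ^ 2 : ℝ) : ℂ)

theorem bump_vanishesAtEnds : VanishesAtEnds bump := by
  refine ⟨?_, fun x hx => if_pos hx, ?_⟩
  · have : bump = fun x : ℝ => ((max x 0 / (1 + max x 0) ^ 2 : ℝ) : ℂ) := by
      funext x
      unfold bump
      split_ifs with h
      · simp [max_eq_right h]
      · simp [max_eq_left (not_le.1 h).le]
    rw [this]
    refine Complex.continuous_ofReal.comp (Continuous.div (by fun_prop) (by fun_prop) fun x => ?_)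
    positivity
  · refine squeeze_zero_norm' (a := fun x : ℝ => x⁻¹) ?_ tendsto_inv_atTop_zero
    filter_upwards [Filter.eventually_gt_atTop 0] with x hx
    rw [bump, if_neg (not_le.2 hx), Complex.norm_real, Real.norm_of_nonneg (by positivity),
      inv_eq_one_div, div_le_div_iff₀ (by positivity) hx]
    nlinarith

theorem modularFunction_bump (K : StandardSubspace H) :
    K.modularFunction bump = K.modularResolvent * (1 - K.modularResolvent) := by
  have hn : IsStarNormal K.modularResolvent :=
    K.modularResolvent_isPositive.isSelfAdjoint.isStarNormal
  have h1 : K.modularFunction bump = cfc (fun z : ℂ => z * (1 - z)) K.modularResolvent := by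
    refine cfc_congr fun z hz => ?_
    obtain ⟨hz, h0, h1⟩ := K.modularResolvent_spectrum hz
    obtain ⟨b, rfl⟩ : ∃ b : ℝ, z = b := ⟨_, hz⟩
    simp only [Complex.ofReal_re] at h0 h1 ⊢
    clear hz
    rcases eq_or_lt_of_le h0 with rfl | h0
    · simp [bump]
    rcases eq_or_lt_of_le h1 with rfl | h1
    · simp [bump]
    have : ¬ b⁻¹ - 1 ≤ 0 := by
      have := (one_lt_inv₀ h0).2 h1
      linarith
    rw [bump, if_neg this]
    have : (b⁻¹ - 1) / (1 + (b⁻¹ - 1)) ^ 2 = b * (1 - b) := by field_simp; ring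
    rw [this]; push_cast; ring
  rw [h1, cfc_mul _ _ _ (by fun_prop) (by fun_prop), cfc_sub _ _ _ (by fun_prop) (by fun_prop),
    cfc_id' ℂ K.modularResolvent, cfc_const_one ℂ K.modularResolvent]

theorem modularFunction_bump_denseRange (K : StandardSubspace H) :
    DenseRange (K.modularFunction bump) := by
  have hsa : IsSelfAdjoint (K.modularFunction bump) := by
    rw [modularFunction_bump]
    have h := K.modularResolvent_isPositive.isSelfAdjoint
    exact (h.commute_iff ((IsSelfAdjoint.one _).sub h)).1
      ((Commute.one_right _).sub_right (Commute.refl _))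
  have hinj : ∀ x, K.modularFunction bump x = 0 → x = 0 := by
    intro x hx
    rw [modularFunction_bump] at hx
    have h1 : x - K.modularResolvent x = 0 := by
      have := (K.modularResolvent_eq_iff (x - K.modularResolvent x) 0).1 hx
      rw [sub_zero] at this
      exact LinearPMap.graph_fst_eq_zero_snd _ this rfl
    have h2 := K.modularResolvent_mem x
    rw [h1] at h2
    rw [sub_eq_zero.1 h1]
    exact modular_injective h2
  have hd := Submodule.dense_iff_topologicalClosure_eq_top
    (s := LinearMap.range (K.modularFunction bump).toLinearMap)
  refine (hd.2 ?_ : Dense _)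
  rw [Submodule.topologicalClosure_eq_top_iff, Submodule.eq_bot_iff]
  intro x hx
  apply hinj
  rw [Submodule.mem_orthogonal] at hx
  refine ext_inner_left ℂ fun y => ?_
  rw [inner_zero_right, ← hx _ ⟨y, rfl⟩]
  exact (hsa.isSymmetric y x).symm

/-- `V = Δ_K^{it}`: for every continuous `f` on `(0, ∞)` vanishing at both ends,
`V f(Δ_K) = g(Δ_K)` with `g(x) = x^{it} f(x)`. -/
def IsModularPower (K : StandardSubspace H) (t : ℝ) (V : H →L[ℂ] H) : Prop :=
  ∀ f : ℝ → ℂ, VanishesAtEnds f →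
    V * K.modularFunction f = K.modularFunction fun x => (x : ℂ) ^ (I * t) * f x

theorem existsUnique_modularPower (K : StandardSubspace H) (t : ℝ) :
    ∃! V : H →L[ℂ] H, K.IsModularPower t V := by
  have hd := K.modularFunction_bump_denseRange
  refine existsUnique_of_exists_of_unique ?_ ?_
  · set C := K.modularFunction bump with hC
    set D := K.modularFunction fun x => (x : ℂ) ^ (I * t) * bump x with hD
    have hstar : star D * D = star C * C := by
      have h1 := (bump_vanishesAtEnds.cpow_mul t).continuousOn.mono
        (fun _ hz => (K.modularResolvent_spectrum hz).2.1 :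
          spectrum ℂ K.modularResolvent ⊆ {z | 0 ≤ z.re})
      have h2 := bump_vanishesAtEnds.continuousOn.mono
        (fun _ hz => (K.modularResolvent_spectrum hz).2.1 :
          spectrum ℂ K.modularResolvent ⊆ {z | 0 ≤ z.re})
      simp only [hC, hD, modularFunction]
      rw [← cfc_star, ← cfc_star, ← cfc_mul _ _ _ h1.star h1, ← cfc_mul _ _ _ h2.star h2]
      refine cfc_congr fun z _ => ?_
      generalize z.re⁻¹ - 1 = x
      rcases le_or_gt x 0 with hx | hx
      · simp [bump, hx]
      · have := norm_cpow_I_mul hx t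
        simp only [star_mul, RCLike.star_def]
        have h3 : (starRingEnd ℂ) ((x : ℂ) ^ (I * t)) * (x : ℂ) ^ (I * t) = 1 := by
          rw [← Complex.normSq_eq_conj_mul_self, Complex.normSq_eq_norm_sq, this]; simp
        linear_combination (starRingEnd ℂ) (bump x) * bump x * h3
    have hnorm : ∀ x, ‖D x‖ = ‖C x‖ := by
      intro x
      have h : ∀ T : H →L[ℂ] H, (‖T x‖ : ℂ) ^ 2 = ⟪x, (star T * T) x⟫ := by
        intro T
        rw [ContinuousLinearMap.star_eq_adjoint]
        change _ = ⟪x, T.adjoint (T x)⟫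
        rw [ContinuousLinearMap.adjoint_inner_right, inner_self_eq_norm_sq_to_K]; rfl
      have h3 : (‖D x‖ : ℂ) ^ 2 = (‖C x‖ : ℂ) ^ 2 := by rw [h, h, hstar]
      norm_cast at h3
      exact (sq_eq_sq₀ (norm_nonneg _) (norm_nonneg _)).1 h3
    let V : H →L[ℂ] H := D.toLinearMap.extendOfNorm C.toLinearMap
    have hV : V * C = D := by
      ext x
      exact LinearMap.extendOfNorm_eq (f := D.toLinearMap) (e := C.toLinearMap) hd
        ⟨1, fun x => by rw [one_mul]; exact (hnorm x).le⟩ x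
    refine ⟨V, fun f hf => ?_⟩
    have hmul : V * K.modularFunction f * C =
        (K.modularFunction fun x => (x : ℂ) ^ (I * t) * f x) * C := by
      rw [mul_assoc, hC, ← modularFunction_mul K hf bump_vanishesAtEnds,
        ← modularFunction_mul K (hf.cpow_mul t) bump_vanishesAtEnds]
      have e1 : (fun x => f x * bump x) = fun x => bump x * f x := by funext x; ring
      rw [e1, modularFunction_mul K bump_vanishesAtEnds hf, ← mul_assoc, ← hC, hV, hD,
        ← modularFunction_mul K (bump_vanishesAtEnds.cpow_mul t) hf]
      congr 1; funext x; ring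
    ext x
    exact congrFun (hd.equalizer (V * K.modularFunction f).continuous
      (K.modularFunction fun x => (x : ℂ) ^ (I * t) * f x).continuous
      (funext fun y => congrArg (fun T : H →L[ℂ] H => T y) hmul)) x
  · intro V V' h h'
    have hmul := (h bump bump_vanishesAtEnds).trans (h' bump bump_vanishesAtEnds).symm
    ext x
    exact congrFun (hd.equalizer V.continuous V'.continuous
      (funext fun y => congrArg (fun T : H →L[ℂ] H => T y) hmul)) x

/-- The modular group `Δ_K^{it}`. -/
def modularGroup (K : StandardSubspace H) (t : ℝ) : H →L[ℂ] H :=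
  (K.existsUnique_modularPower t).choose

theorem modularGroup_spec (K : StandardSubspace H) (t : ℝ) :
    K.IsModularPower t (K.modularGroup t) :=
  (K.existsUnique_modularPower t).choose_spec.1

end StandardSubspace

end ModularTheory

noncomputable section Minkowski

open Matrix
open scoped Pointwise

/-- Minkowski spacetime `ℝ^{1+3}`, with the time coordinate `x 0`. -/
abbrev Spacetime : Type := Fin 4 → ℝ

/-- The Minkowski metric `diag(1, -1, -1, -1)`. -/
def minkowskiMetric : Matrix (Fin 4) (Fin 4) ℝ := Matrix.diagonal ![1, -1, -1, -1]

/-- The Minkowski square `x · x = x₀² - x₁² - x₂² - x₃²`. -/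
def minkowskiSq (x : Spacetime) : ℝ := x ⬝ᵥ minkowskiMetric *ᵥ x

/-- The full Lorentz group. -/
def lorentzGroup : Subgroup (GL (Fin 4) ℝ) where
  carrier := {Λ | (Λ : Matrix (Fin 4) (Fin 4) ℝ)ᵀ * minkowskiMetric * Λ = minkowskiMetric}
  mul_mem' := by
    intro A B hA hB
    simp only [Set.mem_ofPred_eq, Units.val_mul, transpose_mul] at *
    calc _ = (B : Matrix (Fin 4) (Fin 4) ℝ)ᵀ * ((A : Matrix (Fin 4) (Fin 4) ℝ)ᵀ *
          minkowskiMetric * A) * B := by simp only [Matrix.mul_assoc]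
      _ = _ := by rw [hA, hB]
  one_mem' := by simp
  inv_mem' := by
    intro A hA
    simp only [Set.mem_ofPred_eq] at *
    have h1 : (A : Matrix (Fin 4) (Fin 4) ℝ) * ((A⁻¹ : GL (Fin 4) ℝ) : Matrix (Fin 4) (Fin 4) ℝ)
        = 1 := by rw [← Units.val_mul]; simp
    have h2 : ((A⁻¹ : GL (Fin 4) ℝ) : Matrix (Fin 4) (Fin 4) ℝ)ᵀ *
        (A : Matrix (Fin 4) (Fin 4) ℝ)ᵀ = 1 := by
      rw [← transpose_mul, h1, transpose_one]
    conv_lhs => rw [← hA]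
    calc _ = (((A⁻¹ : GL (Fin 4) ℝ) : Matrix (Fin 4) (Fin 4) ℝ)ᵀ *
          (A : Matrix (Fin 4) (Fin 4) ℝ)ᵀ) * minkowskiMetric * ((A : Matrix (Fin 4) (Fin 4) ℝ) *
          ((A⁻¹ : GL (Fin 4) ℝ) : Matrix (Fin 4) (Fin 4) ℝ)) := by simp only [Matrix.mul_assoc]
      _ = _ := by rw [h1, h2]; simp

/-- The proper orthochronous Lorentz group, the connected component of the identity in the
Lorentz group. -/
def properLorentz : Subgroup lorentzGroup := Subgroup.connectedComponentOfOne lorentzGroup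

/-- The matrix of an element of the proper orthochronous Lorentz group. -/
def lorentzMatrix (Λ : properLorentz) : Matrix (Fin 4) (Fin 4) ℝ :=
  ((Λ : lorentzGroup) : GL (Fin 4) ℝ)

theorem lorentzMatrix_one : lorentzMatrix 1 = 1 := rfl

theorem lorentzMatrix_mul (Λ M : properLorentz) :
    lorentzMatrix (Λ * M) = lorentzMatrix Λ * lorentzMatrix M := rfl

theorem lorentzMatrix_isometry (Λ : properLorentz) (x : Spacetime) :
    minkowskiSq (lorentzMatrix Λ *ᵥ x) = minkowskiSq x := by
  have h : (lorentzMatrix Λ)ᵀ * minkowskiMetric * lorentzMatrix Λ = minkowskiMetric :=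
    (Λ : lorentzGroup).2
  unfold minkowskiSq
  conv_rhs => rw [← h]
  rw [← Matrix.mulVec_mulVec, ← Matrix.mulVec_mulVec, Matrix.dotProduct_mulVec _ (lorentzMatrix Λ)ᵀ,
    Matrix.vecMul_transpose]

/-- The action of Lorentz transformations on the additive group of translations. -/
def lorentzAut : properLorentz →* MulAut (Multiplicative Spacetime) where
  toFun Λ :=
    { toFun := fun a => Multiplicative.ofAdd (lorentzMatrix Λ *ᵥ a.toAdd)
      invFun := fun a => Multiplicative.ofAdd (lorentzMatrix Λ⁻¹ *ᵥ a.toAdd)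
      left_inv := fun a => by
        simp [Matrix.mulVec_mulVec, ← lorentzMatrix_mul, lorentzMatrix_one]
      right_inv := fun a => by
        simp [Matrix.mulVec_mulVec, ← lorentzMatrix_mul, lorentzMatrix_one]
      map_mul' := fun a b => by simp [Matrix.mulVec_add] }
  map_one' := by ext a; simp [lorentzMatrix_one]
  map_mul' Λ M := by ext a; simp [lorentzMatrix_mul, Matrix.mulVec_mulVec]

/-- The proper orthochronous Poincaré group: the semidirect product of the translations and the
proper orthochronous Lorentz group. -/
abbrev Poincare : Type := Multiplicative Spacetime ⋊[lorentzAut] properLorentz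

/-- The Poincaré transformation `x ↦ Λ x + a`. -/
def poincare (a : Spacetime) (Λ : properLorentz) : Poincare := ⟨Multiplicative.ofAdd a, Λ⟩

/-- The translation `x ↦ x + a`. -/
def translation (a : Spacetime) : Poincare := poincare a 1

/-- The pure Lorentz transformation `x ↦ Λ x`. -/
def lorentz (Λ : properLorentz) : Poincare := poincare 0 Λ

/-- The action `x ↦ Λ x + a` of the Poincaré group on spacetime. -/
instance : MulAction Poincare Spacetime where
  smul g x := lorentzMatrix g.right *ᵥ x + g.left.toAdd
  one_smul x := by
    change lorentzMatrix 1 *ᵥ x + 0 = x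
    simp [lorentzMatrix_one]
  mul_smul g h x := by
    change lorentzMatrix (g.right * h.right) *ᵥ x
        + (g.left.toAdd + lorentzMatrix g.right *ᵥ h.left.toAdd)
      = lorentzMatrix g.right *ᵥ (lorentzMatrix h.right *ᵥ x + h.left.toAdd) + g.left.toAdd
    rw [lorentzMatrix_mul, Matrix.mulVec_add, Matrix.mulVec_mulVec]
    abel

theorem poincare_smul_def (g : Poincare) (x : Spacetime) :
    g • x = lorentzMatrix g.right *ᵥ x + g.left.toAdd := rfl

theorem poincare_smul_sub (g : Poincare) (x y : Spacetime) :
    minkowskiSq (g • x - g • y) = minkowskiSq (x - y) := by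
  rw [poincare_smul_def, poincare_smul_def, add_sub_add_right_eq_sub, ← Matrix.mulVec_sub,
    lorentzMatrix_isometry]

instance : ContinuousConstSMul Poincare Spacetime where
  continuous_const_smul g := by
    have : (fun x : Spacetime => g • x) =
      fun x => lorentzMatrix g.right *ᵥ x + g.left.toAdd := rfl
    rw [this]
    fun_prop

/-- A path of Lorentz transformations starting at the identity stays in the identity component. -/
theorem mem_properLorentz_of_path (γ : ℝ → lorentzGroup) (hγ : Continuous γ) (h0 : γ 0 = 1)
    (t : ℝ) : γ t ∈ properLorentz :=
  (isPreconnected_range hγ).subset_connectedComponent ⟨0, h0⟩ ⟨t, rfl⟩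

/-- Builds a Lorentz transformation from its matrix and the matrix of its inverse. -/
def mkLorentz (A B : Matrix (Fin 4) (Fin 4) ℝ) (h1 : A * B = 1) (h2 : B * A = 1)
    (h : Aᵀ * minkowskiMetric * A = minkowskiMetric) : lorentzGroup :=
  ⟨⟨A, B, h1, h2⟩, h⟩

/-- The matrix of the boost with rapidity `t` in the `x₁` direction. -/
def boostMatrix (t : ℝ) : Matrix (Fin 4) (Fin 4) ℝ :=
  !![Real.cosh t, Real.sinh t, 0, 0; Real.sinh t, Real.cosh t, 0, 0; 0, 0, 1, 0; 0, 0, 0, 1]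

theorem boostMatrix_mul_neg (t : ℝ) : boostMatrix t * boostMatrix (-t) = 1 := by
  have := Real.cosh_sq t
  ext i j
  fin_cases i <;> fin_cases j <;>
    simp [boostMatrix, Matrix.mul_apply, Fin.sum_univ_four] <;> nlinarith

theorem boostMatrix_isometry (t : ℝ) :
    (boostMatrix t)ᵀ * minkowskiMetric * boostMatrix t = minkowskiMetric := by
  have := Real.cosh_sq t
  ext i j
  fin_cases i <;> fin_cases j <;>
    simp [boostMatrix, minkowskiMetric, Matrix.mul_apply, Fin.sum_univ_four,
      Matrix.diagonal_apply] <;> nlinarith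

/-- The boost `(x₀, x₁) ↦ (cosh t x₀ + sinh t x₁, sinh t x₀ + cosh t x₁)` in the Lorentz group. -/
def boostFull (t : ℝ) : lorentzGroup :=
  mkLorentz (boostMatrix t) (boostMatrix (-t)) (boostMatrix_mul_neg t)
    (by simpa using boostMatrix_mul_neg (-t)) (boostMatrix_isometry t)

theorem continuous_boostMatrix : Continuous boostMatrix := by
  refine continuous_matrix fun i j => ?_
  fin_cases i <;> fin_cases j <;> simp [boostMatrix] <;> fun_prop

theorem continuous_boostFull : Continuous boostFull := by
  refine Continuous.subtype_mk (f := fun t => (boostFull t : GL (Fin 4) ℝ))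
    (Units.continuous_iff.2 ⟨continuous_boostMatrix, ?_⟩) _
  exact continuous_boostMatrix.comp continuous_neg

theorem boostMatrix_zero : boostMatrix 0 = 1 := by
  ext i j; fin_cases i <;> fin_cases j <;> simp [boostMatrix]

theorem boostFull_zero : boostFull 0 = 1 :=
  Subtype.ext (Units.ext boostMatrix_zero)

/-- The boosts in the `x₁` direction in the proper orthochronous Lorentz group. -/
def boost (t : ℝ) : properLorentz :=
  ⟨boostFull t, mem_properLorentz_of_path _ continuous_boostFull boostFull_zero t⟩

/-- The matrix of the rotation by the angle `t` in the `(x₁, x₂)` plane. -/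
def rotationMatrix (t : ℝ) : Matrix (Fin 4) (Fin 4) ℝ :=
  !![1, 0, 0, 0; 0, Real.cos t, -Real.sin t, 0; 0, Real.sin t, Real.cos t, 0; 0, 0, 0, 1]

theorem rotationMatrix_mul_neg (t : ℝ) : rotationMatrix t * rotationMatrix (-t) = 1 := by
  have := Real.sin_sq_add_cos_sq t
  ext i j
  fin_cases i <;> fin_cases j <;>
    simp [rotationMatrix, Matrix.mul_apply, Fin.sum_univ_four] <;> nlinarith

theorem rotationMatrix_isometry (t : ℝ) :
    (rotationMatrix t)ᵀ * minkowskiMetric * rotationMatrix t = minkowskiMetric := by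
  have := Real.sin_sq_add_cos_sq t
  ext i j
  fin_cases i <;> fin_cases j <;>
    simp [rotationMatrix, minkowskiMetric, Matrix.mul_apply, Fin.sum_univ_four,
      Matrix.diagonal_apply] <;> nlinarith

/-- The rotation by the angle `t` in the `(x₁, x₂)` plane, in the Lorentz group. -/
def rotationFull (t : ℝ) : lorentzGroup :=
  mkLorentz (rotationMatrix t) (rotationMatrix (-t)) (rotationMatrix_mul_neg t)
    (by simpa using rotationMatrix_mul_neg (-t)) (rotationMatrix_isometry t)

theorem continuous_rotationMatrix : Continuous rotationMatrix := by
  refine continuous_matrix fun i j => ?_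
  fin_cases i <;> fin_cases j <;> simp [rotationMatrix] <;> fun_prop

theorem continuous_rotationFull : Continuous rotationFull := by
  refine Continuous.subtype_mk (f := fun t => (rotationFull t : GL (Fin 4) ℝ))
    (Units.continuous_iff.2 ⟨continuous_rotationMatrix, ?_⟩) _
  exact continuous_rotationMatrix.comp continuous_neg

theorem rotationFull_zero : rotationFull 0 = 1 := by
  refine Subtype.ext (Units.ext ?_)
  change rotationMatrix 0 = 1
  ext i j; fin_cases i <;> fin_cases j <;> simp [rotationMatrix]

/-- The rotations in the `(x₁, x₂)` plane in the proper orthochronous Lorentz group. -/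
def spaceRotation (t : ℝ) : properLorentz :=
  ⟨rotationFull t, mem_properLorentz_of_path _ continuous_rotationFull rotationFull_zero t⟩

/-- The causal complement of a region: the interior of the set of the points that are spacelike
separated from all its points. -/
def causalComplement (O : Set Spacetime) : Set Spacetime :=
  interior {x | ∀ y ∈ O, minkowskiSq (x - y) < 0}

/-- The right wedge `W₁ = {x | |x₀| < x₁}`. -/
def rightWedge : Set Spacetime := {x | |x 0| < x 1}

/-- Wedges: the regions `g W₁` with `g` in the proper orthochronous Poincaré group. -/
def Wedge : Type := {W : Set Spacetime // ∃ g : Poincare, W = g • rightWedge}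

theorem minkowskiSq_eq (x : Spacetime) :
    minkowskiSq x = x 0 ^ 2 - x 1 ^ 2 - x 2 ^ 2 - x 3 ^ 2 := by
  simp [minkowskiSq, minkowskiMetric, Matrix.mulVec_diagonal, dotProduct, Fin.sum_univ_four]
  ring

theorem causalComplement_smul (g : Poincare) (O : Set Spacetime) :
    causalComplement (g • O) = g • causalComplement O := by
  unfold causalComplement
  rw [← interior_smul]
  congr 1
  ext x
  rw [Set.mem_smul_set_iff_inv_smul_mem]
  simp only [Set.mem_ofPred_eq]
  constructor
  · intro h y hy
    have := h (g • y) (Set.smul_mem_smul_set hy)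
    rwa [← poincare_smul_sub g, smul_inv_smul]
  · rintro h _ ⟨y, hy, rfl⟩
    have := h y hy
    rwa [← poincare_smul_sub g, smul_inv_smul] at this

theorem causalComplement_rightWedge :
    causalComplement rightWedge = {x : Spacetime | x 1 < -|x 0|} := by
  have key : ∀ x : Spacetime, (∀ y ∈ rightWedge, minkowskiSq (x - y) < 0) → x 1 ≤ -|x 0| := by
    intro x hx
    by_contra! hlt
    have hS : ∀ σ : ℝ, (σ = 1 ∨ σ = -1) → 0 < σ * x 0 + x 1 → False := by
      intro σ hσ hpos
      let s : ℝ := |x 0| + |x 1| + 1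
      have hy := hx ![x 0 - σ * s, x 1 + s, x 2, x 3] (by
        change |x 0 - σ * s| < x 1 + s
        have a1 := abs_le.1 (le_refl |x 0|)
        have a2 := abs_le.1 (le_refl |x 1|)
        rw [abs_lt]
        rcases hσ with rfl | rfl <;> constructor <;> simp only [s] <;> linarith)
      rw [minkowskiSq_eq] at hy
      simp at hy
      rcases hσ with rfl | rfl <;> linarith
    rcases le_total 0 (x 0) with h0 | h0
    · rw [abs_of_nonneg h0] at hlt
      exact hS 1 (Or.inl rfl) (by linarith)
    · rw [abs_of_nonpos h0] at hlt
      exact hS (-1) (Or.inr rfl) (by linarith)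
  apply Set.Subset.antisymm
  · intro x hx
    have hcont : Filter.Tendsto (fun ε : ℝ => x + ε • Pi.single (1 : Fin 4) (1 : ℝ))
        (nhdsWithin 0 (Set.Ioi 0)) (nhds x) := by
      have : Continuous fun ε : ℝ => x + ε • (Pi.single (1 : Fin 4) (1 : ℝ) : Spacetime) := by
        fun_prop
      have h := this.tendsto 0
      simp only [zero_smul, add_zero] at h
      exact h.mono_left nhdsWithin_le_nhds
    have hev := hcont.eventually (mem_interior_iff_mem_nhds.1 hx)
    obtain ⟨ε, hε, hpos⟩ := (hev.and self_mem_nhdsWithin).exists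
    have := key _ hε
    simp at this
    have hp : 0 < ε := hpos
    change x 1 < -|x 0|
    linarith
  · refine interior_maximal ?_ ?_
    · intro x hx y hy
      have hx' : x 1 < -|x 0| := hx
      have hy' : |y 0| < y 1 := hy
      rw [minkowskiSq_eq]
      have h1 : |x 0 - y 0| < y 1 - x 1 := by
        calc |x 0 - y 0| ≤ |x 0| + |y 0| := abs_sub _ _
          _ < _ := by linarith
      have h2 := sq_lt_sq' (abs_lt.1 h1).1 (abs_lt.1 h1).2
      simp only [Pi.sub_apply]
      nlinarith [sq_nonneg (x 2 - y 2), sq_nonneg (x 3 - y 3)]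
    · exact isOpen_lt (by fun_prop) (by fun_prop)

theorem spaceRotation_smul_rightWedge :
    lorentz (spaceRotation Real.pi) • rightWedge = {x : Spacetime | x 1 < -|x 0|} := by
  have hmat : ∀ x : Spacetime, lorentz (spaceRotation Real.pi) • x = ![x 0, -x 1, -x 2, x 3] := by
    intro x
    change rotationMatrix Real.pi *ᵥ x + 0 = _
    ext i
    fin_cases i <;> simp [rotationMatrix, dotProduct, Fin.sum_univ_four]
  ext x
  constructor
  · rintro ⟨y, hy, rfl⟩
    have hy' : |y 0| < y 1 := hy
    simp only [hmat]
    change -y 1 < -|y 0|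
    linarith
  · intro hx
    have hx' : x 1 < -|x 0| := hx
    refine ⟨![x 0, -x 1, -x 2, x 3], ?_, ?_⟩
    · change |x 0| < -x 1
      linarith
    · simp only [hmat]
      ext i
      fin_cases i <;> simp

namespace Wedge

instance : MulAction Poincare Wedge where
  smul g W := ⟨g • W.1, by
    obtain ⟨h, hh⟩ := W.2
    exact ⟨g * h, by rw [hh, mul_smul]⟩⟩
  one_smul W := Subtype.ext (one_smul Poincare W.1)
  mul_smul g h W := Subtype.ext (mul_smul g h W.1)

/-- The wedge `W'`, the causal complement of the wedge `W`. -/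
def compl (W : Wedge) : Wedge :=
  ⟨causalComplement W.1, by
    obtain ⟨g, hg⟩ := W.2
    refine ⟨g * lorentz (spaceRotation Real.pi), ?_⟩
    rw [hg, causalComplement_smul, causalComplement_rightWedge, mul_smul,
      spaceRotation_smul_rightWedge]⟩

/-- The one-parameter group of boosts `Λ_W(t) = g Λ_{W₁}(t) g⁻¹` of a wedge `W = g W₁`. The
stabilizer of `W₁` commutes with the boosts `Λ_{W₁}(t)`, so `g` may be chosen at will. -/
def boosts (W : Wedge) (t : ℝ) : Poincare :=
  W.2.choose * lorentz (boost t) * W.2.choose⁻¹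

end Wedge

end Minkowski

noncomputable section Nets

open Complex
open scoped ComplexInnerProductSpace

/-- The closed forward light cone. -/
def forwardCone : Set Spacetime := {a | 0 ≤ a 0 ∧ 0 ≤ minkowskiSq a}

/-- A strongly continuous unitary representation of the proper orthochronous Poincaré group with
positive energy: for every `a` in the closed forward cone, the self-adjoint generator `P_a` of the
translations `U(s a) = exp(i s P_a)` is positive. If `φ` is the derivative of `s ↦ U(s a) ψ` at `0`
then `ψ` is in the domain of `P_a` and `P_a ψ = -i φ`. -/
structure PositiveEnergyRep (H : Type*) [NormedAddCommGroup H] [InnerProductSpace ℂ H]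
    [CompleteSpace H] where
  toHom : Poincare →* unitary (H →L[ℂ] H)
  continuous : ∀ ψ : H, Continuous fun p : Spacetime × properLorentz =>
    (toHom (poincare p.1 p.2) : H →L[ℂ] H) ψ
  positive_energy : ∀ a ∈ forwardCone, ∀ ψ φ : H,
    HasDerivAt (fun s : ℝ => (toHom (translation (s • a)) : H →L[ℂ] H) ψ) φ 0 →
      0 ≤ (⟪ψ, -I • φ⟫).re

/-- The unitary operator `U(g)`. -/
def PositiveEnergyRep.op {H : Type*} [NormedAddCommGroup H] [InnerProductSpace ℂ H]
    [CompleteSpace H] (U : PositiveEnergyRep H) (g : Poincare) : H →L[ℂ] H :=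
  (U.toHom g : H →L[ℂ] H)

/-- A local Poincaré covariant net of standard subspaces on wedges. -/
structure CovariantNet {H : Type*} [NormedAddCommGroup H] [InnerProductSpace ℂ H]
    [CompleteSpace H] (U : PositiveEnergyRep H) where
  space : Wedge → ClosedSubmodule ℝ H
  isotony : ∀ W₁ W₂ : Wedge, W₁.1 ⊆ W₂.1 → space W₁ ≤ space W₂
  covariance : ∀ (W : Wedge) (g : Poincare),
    U.op g '' (space W : Set H) = (space (g • W) : Set H)
  cyclic : ∀ W : Wedge, space W ⊔ (space W).mulI = ⊤
  locality : ∀ W₁ W₂ : Wedge, W₁.1 ⊆ W₂.compl.1 → space W₁ ≤ (space W₂).symplComp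

namespace CovariantNet

open ClosedSubmodule

variable {H : Type*} [NormedAddCommGroup H] [InnerProductSpace ℂ H] [CompleteSpace H]
  {U : PositiveEnergyRep H}

theorem separating (N : CovariantNet U) (W : Wedge) :
    N.space W ⊓ (N.space W).mulI = ⊥ := by
  have h1 : N.space W.compl ≤ (N.space W).symplComp := N.locality _ _ subset_rfl
  have h2 : (N.space W).symplComp ⊔ (N.space W).symplComp.mulI = ⊤ := by
    rw [eq_top_iff, ← N.cyclic W.compl]
    refine sup_le_sup h1 fun x hx => ?_
    rw [mem_mapEquiv_iff] at hx ⊢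
    exact h1 hx
  rw [← symplComp_symplComp_eq (S := N.space W ⊓ (N.space W).mulI), symplComp_inf,
    ← mulI_symplComp, h2]
  refine le_bot_iff.1 fun x hx => ?_
  have hx' := mem_symplComp_iff.1 hx (I • x) trivial
  have h3 : ‖x‖ ^ 2 = 0 := by
    rw [inner_smul_left, inner_self_eq_norm_sq_to_K] at hx'
    simpa [← ofReal_pow] using hx'
  simpa using h3

/-- The subspace `H(W)`, which is standard: it is separating by locality and cyclicity. -/
def standard (N : CovariantNet U) (W : Wedge) : StandardSubspace H :=
  ⟨N.space W, N.separating W, N.cyclic W⟩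

/-- The operators `Z_{H(W)}(t) = Δ_{H(W)}^{it} U(Λ_W(2πt))`. -/
def Z (N : CovariantNet U) (W : Wedge) (t : ℝ) : H →L[ℂ] H :=
  (N.standard W).modularGroup t * U.op (W.boosts (2 * Real.pi * t))

/-- The Bisognano–Wichmann property: `U(Λ_W(2πt)) = Δ_{H(W)}^{-it}`. -/
def BisognanoWichmann (N : CovariantNet U) : Prop :=
  ∀ (W : Wedge) (t : ℝ),
    U.op (W.boosts (2 * Real.pi * t)) = (N.standard W).modularGroup (-t)

/-- Wedge duality: `H(W) = H(W')'`. -/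
def WedgeDuality (N : CovariantNet U) : Prop :=
  ∀ W : Wedge, N.space W = (N.space W.compl).symplComp

end CovariantNet

end Nets

/-! Write Δ for the modular operator of `H(W)`. Since `r W = W'`, conjugation by `U(r)` turns
`Δ^{it}` into the modular group of `H(W')`, and it reverses the boosts of `W`. Commutation of `Z`
with `U(r)` therefore says `Δ^{it} U(Λ_W(4πt)) = Δ_{H(W')}^{it}` (`modularGroup_compl`). Boosts of
`W` and the modular group of `H(W')` both preserve `H(W')`, hence so does `Δ^{it}`. By locality
`H(W')` is a cyclic subspace of `H(W)'`, whose modular group is `Δ^{-it}`; a cyclic subspace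
invariant under the modular group is the whole space (`eq_of_le_of_modularGroup_invariant`), so
`H(W') = H(W)'`. Now `Δ_{H(W')}^{it} = Δ^{-it}`, and the displayed identity becomes `U(Λ_W(4πt)) =
Δ^{-2it}`. Covariance carries both conclusions to every wedge.

The modular theory is done with bounded operators. The real projection `P` onto `K` is not complex
linear, so it can be expected to commute only with those `f(Δ)` for which `f(1/x)` is the conjugate
of `f(x)`; these are limits of real polynomials in `skew = i(Δ-1)/(Δ+1)`. The projection formula
gives `skew = i - iP - Pi`, which commutes with `P`; hence `P` commutes with `Δ^{it}`
(`proj_modularGroup`). Conversely, a real operator commuting with `Δ^{it}` commutes with `skew`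
(`apply_skew_comm_of_modularGroup`). If this operator is the projection onto `L ⊆ K`, then `skew`
preserves `L`. On `K` it acts as `ξ ↦ -P(iξ)`, so a vector of `K` orthogonal to `L` is also
orthogonal to `iL`, and cyclicity of `L` makes it zero.

The geometric input is that the stabilizer of `W₁` commutes with its boosts
(`commute_boost_of_stabilizer`), so any `r` with `r W = W'` reverses the boosts, as the rotation by
π does. -/

noncomputable section Approximation

open Complex Polynomial

/-! ### Estimates for `tanh` and `sin`, and approximation by real polynomials. -/

/-- The function `y ↦ (e^y - 1) / (e^y + 1)`, that is `tanh (y / 2)`. -/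
def halfTanh (y : ℝ) : ℝ := (Real.exp y - 1) / (Real.exp y + 1)

theorem hasDerivAt_halfTanh (y : ℝ) :
    HasDerivAt halfTanh (2 * Real.exp y / (Real.exp y + 1) ^ 2) y := by
  have hne : Real.exp y + 1 ≠ 0 := by positivity
  have h := ((Real.hasDerivAt_exp y).sub_const 1).div ((Real.hasDerivAt_exp y).add_const 1) hne
  exact HasDerivAt.congr_deriv (f := halfTanh) h (by ring)

theorem continuous_halfTanh : Continuous halfTanh :=
  continuous_iff_continuousAt.2 fun y => (hasDerivAt_halfTanh y).continuousAt

theorem halfTanh_neg (y : ℝ) : halfTanh (-y) = -halfTanh y := by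
  have hy := Real.exp_pos y
  unfold halfTanh
  rw [Real.exp_neg]
  field_simp
  ring

theorem halfTanh_log {x : ℝ} (hx : 0 < x) : halfTanh (Real.log x) = (x - 1) / (x + 1) := by
  rw [halfTanh, Real.exp_log hx]

/-- The derivative is at most `1/2` because `(e^y + 1)² ≥ 4 e^y`. -/
theorem abs_halfTanh_sub_le (x y : ℝ) : |halfTanh y - halfTanh x| ≤ 1 / 2 * |y - x| := by
  refine Convex.norm_image_sub_le_of_norm_hasDerivWithin_le (𝕜 := ℝ) (s := Set.univ)
    (fun y _ => (hasDerivAt_halfTanh y).hasDerivWithinAt) (fun y _ => ?_) convex_univ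
    (Set.mem_univ x) (Set.mem_univ y)
  have hy := Real.exp_pos y
  rw [Real.norm_of_nonneg (by positivity), div_le_div_iff₀ (by positivity) (by norm_num)]
  nlinarith [sq_nonneg (Real.exp y - 1)]

theorem abs_sin_sub_le (y : ℝ) : |Real.sin y - y| ≤ |y| ^ 3 / 6 := by
  have key : ∀ y : ℝ, 0 < y → |Real.sin y - y| ≤ |y| ^ 3 / 6 := by
    intro y hy
    rw [abs_of_pos hy, abs_le]
    have h1 := Real.sin_gt_sub_cube hy
    have h2 := Real.sin_lt hy
    constructor <;> nlinarith [pow_pos hy 3]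
  rcases lt_trichotomy y 0 with hy | rfl | hy
  · have h := key (-y) (by linarith)
    rw [Real.sin_neg, abs_neg, show -Real.sin y - -y = -(Real.sin y - y) by ring, abs_neg] at h
    exact h
  · simp
  · exact key y hy

/-- The cubic term of the exponential series gives `|log x|³ ≤ 3! e^{|log x|}`, and `e^{|log x|} =
max(x, 1/x)` is at most `(1 + x)² / x`. Thus the weight `bump` absorbs the cubic error of `sin y ≈
y`. -/
theorem abs_log_pow_mul_le {x : ℝ} (hx : 0 < x) : |Real.log x| ^ 3 * (x / (1 + x) ^ 2) ≤ 6 := by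
  have h1 : |Real.log x| ^ 3 / 6 ≤ Real.exp |Real.log x| := by
    have := Real.pow_div_factorial_le_exp _ (abs_nonneg (Real.log x)) 3
    norm_num [Nat.factorial] at this
    exact this
  have h2 : Real.exp |Real.log x| * x ≤ (1 + x) ^ 2 := by
    rcases abs_cases (Real.log x) with ⟨h, _⟩ | ⟨h, _⟩
    · rw [h, Real.exp_log hx]; nlinarith
    · rw [h, Real.exp_neg, Real.exp_log hx, inv_mul_cancel₀ hx.ne']; nlinarith
  rw [← mul_div_assoc, div_le_iff₀ (by positivity)]
  nlinarith

/-- This replaces `log x` by `sin(s log x)/s`, a combination of `x^{is}` and `x^{-is}`, with an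
error that is uniform in `x` once weighted. -/
theorem abs_halfTanh_sin_sub_mul_le {s : ℝ} (hs : 0 < s) {x : ℝ} (hx : 0 < x) :
    |halfTanh (Real.sin (s * Real.log x) / s) - halfTanh (Real.log x)| * (x / (1 + x) ^ 2)
      ≤ s ^ 2 := by
  set l := Real.log x
  have hb : 0 ≤ x / (1 + x) ^ 2 := by positivity
  have h1 := abs_halfTanh_sub_le l (Real.sin (s * l) / s)
  have h2 : |Real.sin (s * l) / s - l| ≤ s ^ 2 * |l| ^ 3 / 6 := by
    have h3 := abs_sin_sub_le (s * l)
    rw [show Real.sin (s * l) / s - l = (Real.sin (s * l) - s * l) / s by field_simp, abs_div,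
      abs_of_pos hs, div_le_iff₀ hs]
    rw [abs_mul, abs_of_pos hs] at h3
    linarith
  have h4 := abs_log_pow_mul_le hx
  -- The 12 is the Lipschitz constant `1/2` times the `1/6` of the sine remainder.
  calc _ ≤ (s ^ 2 * |l| ^ 3 / 12) * (x / (1 + x) ^ 2) := by gcongr; linarith
    _ = s ^ 2 / 12 * (|l| ^ 3 * (x / (1 + x) ^ 2)) := by ring
    _ ≤ s ^ 2 / 12 * 6 := by gcongr
    _ ≤ s ^ 2 := by nlinarith [sq_nonneg s]

/-- Even powers of `iu` are real and odd ones imaginary, so the even part of a real polynomial, and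
`i` times its odd part, are real polynomials in `iu`. -/
theorem exists_polynomial_eval_I_mul (a : ℝ[X]) :
    ∃ p q : ℝ[X], ∀ u : ℝ,
      (p.map (algebraMap ℝ ℂ)).eval (I * u) = ((a.eval u + a.eval (-u)) / 2 : ℝ) ∧
      (q.map (algebraMap ℝ ℂ)).eval (I * u) = I * ((a.eval u - a.eval (-u)) / 2 : ℝ) := by
  induction a using Polynomial.induction_on' with
  | add a b ha hb =>
    obtain ⟨p, q, h⟩ := ha
    obtain ⟨p', q', h'⟩ := hb
    refine ⟨p + p', q + q', fun u => ⟨?_, ?_⟩⟩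
    · rw [Polynomial.map_add, eval_add, (h u).1, (h' u).1]; simp only [eval_add]; push_cast; ring
    · rw [Polynomial.map_add, eval_add, (h u).2, (h' u).2]; simp only [eval_add]; push_cast; ring
  | monomial n c =>
    rcases Nat.even_or_odd' n with ⟨k, rfl | rfl⟩
    · refine ⟨Polynomial.C ((-1) ^ k * c) * X ^ (2 * k), 0, fun u => ⟨?_, ?_⟩⟩
      · simp only [Polynomial.map_mul, Polynomial.map_pow, map_C, map_X, eval_mul, eval_C, eval_pow,
          eval_X, eval_monomial, mul_pow, pow_mul, I_sq, neg_sq]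
        push_cast [Complex.coe_algebraMap]
        have : ((-1 : ℂ) ^ k) * (-1) ^ k = 1 := by rw [← mul_pow]; simp
        linear_combination (c : ℂ) * ((u : ℂ) ^ 2) ^ k * this
      · simp [pow_mul]
    · refine ⟨0, Polynomial.C ((-1) ^ k * c) * X ^ (2 * k + 1), fun u => ⟨?_, ?_⟩⟩
      · simp [pow_succ, pow_mul]
      · simp only [Polynomial.map_mul, Polynomial.map_pow, map_C, map_X, eval_mul, eval_C, eval_pow,
          eval_X, eval_monomial, mul_pow, pow_mul, pow_succ _ (2 * k), I_sq, neg_sq]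
        push_cast [Complex.coe_algebraMap]
        have : ((-1 : ℂ) ^ k) * (-1) ^ k = 1 := by rw [← mul_pow]; simp
        linear_combination (c : ℂ) * I * ((u : ℂ) ^ 2) ^ k * u * this

/-- Weierstrass approximation of functions with `h (-u) = conj (h u)` by real polynomials
in `i u`. -/
theorem exists_real_polynomial_near {h : ℝ → ℂ} (hc : ContinuousOn h (Set.Icc (-1) 1))
    (hs : ∀ u ∈ Set.Icc (-1 : ℝ) 1, h (-u) = (starRingEnd ℂ) (h u)) {ε : ℝ} (hε : 0 < ε) :
    ∃ q : ℝ[X], ∀ u ∈ Set.Icc (-1 : ℝ) 1, ‖(q.map (algebraMap ℝ ℂ)).eval (I * u) - h u‖ ≤ ε := by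
  obtain ⟨a, ha⟩ := exists_polynomial_near_of_continuousOn (-1) 1 (fun u => (h u).re)
    (Complex.continuous_re.comp_continuousOn hc) (ε / 2) (by positivity)
  obtain ⟨b, hb⟩ := exists_polynomial_near_of_continuousOn (-1) 1 (fun u => (h u).im)
    (Complex.continuous_im.comp_continuousOn hc) (ε / 2) (by positivity)
  -- The symmetry of `h` makes its real part even and its imaginary part odd, so passing to the even
  -- part of `a` and the odd part of `b` loses no accuracy.
  obtain ⟨p, _, hp⟩ := exists_polynomial_eval_I_mul a
  obtain ⟨_, q, hq⟩ := exists_polynomial_eval_I_mul b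
  refine ⟨p + q, fun u hu => ?_⟩
  have hu' : -u ∈ Set.Icc (-1 : ℝ) 1 := ⟨by linarith [hu.2], by linarith [hu.1]⟩
  have ha1 := abs_lt.1 (ha u hu)
  have ha2 := abs_lt.1 (ha (-u) hu')
  have hb1 := abs_lt.1 (hb u hu)
  have hb2 := abs_lt.1 (hb (-u) hu')
  simp only [hs u hu, conj_re, conj_im] at ha2 hb2
  rw [Polynomial.map_add, eval_add, (hp u).1, (hq u).2]
  refine (Complex.norm_le_abs_re_add_abs_im _).trans ?_
  simp only [sub_re, add_re, ofReal_re, mul_re, I_re, I_im, ofReal_im, sub_im, add_im, mul_im]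
  have h1 : |(a.eval u + a.eval (-u)) / 2 + (0 * ((b.eval u - b.eval (-u)) / 2) - 1 * 0)
      - (h u).re| ≤ ε / 2 := by rw [abs_le]; constructor <;> linarith
  have h2 : |0 + (0 * 0 + 1 * ((b.eval u - b.eval (-u)) / 2)) - (h u).im| ≤ ε / 2 := by
    rw [abs_le]; constructor <;> linarith
  linarith

end Approximation

/-! ### Real projections and the functional calculus of `skew`. -/

noncomputable section ModularTheory

namespace StandardSubspace

open Complex ClosedSubmodule Polynomial
open scoped ComplexOrder ComplexInnerProductSpace InnerProduct

variable {H : Type*} [NormedAddCommGroup H] [InnerProductSpace ℂ H]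

/-- `T` is only real linear, so coefficients must be real to pass through it. -/
theorem apply_aeval_comm {T : H →L[ℝ] H} {A : H →L[ℂ] H} (h : ∀ x, T (A x) = A (T x))
    (q : ℝ[X]) (x : H) :
    T (aeval A (q.map (algebraMap ℝ ℂ)) x) = aeval A (q.map (algebraMap ℝ ℂ)) (T x) := by
  induction q using Polynomial.induction_on' with
  | add p q hp hq =>
    rw [Polynomial.map_add, map_add, add_apply, map_add, hp, hq,
      add_apply]
  | monomial n c =>
    have hn : ∀ y, T ((A ^ n) y) = (A ^ n) (T y) := by
      induction n with
      | zero => simp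
      | succ n ih =>
        intro y
        rw [pow_succ, mul_apply_eq_comp, ih, h, mul_apply_eq_comp]
    simp only [map_monomial, aeval_monomial]
    change T ((c : ℂ) • (A ^ n) x) = (c : ℂ) • (A ^ n) (T x)
    rw [Complex.coe_smul, Complex.coe_smul, map_smul, hn]

/-- The flanking `M` and `N` allow commutation to be tested in a regularized form; they are taken to
be `1` or the operator of `bump`. -/
theorem isClosed_apply_comm (T : H →L[ℝ] H) (M N : H →L[ℂ] H) :
    IsClosed {A : H →L[ℂ] H | ∀ x, M (T (A x)) = A (T (N x))} := by
  simp only [Set.ofPred_forall]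
  refine isClosed_iInter fun x => isClosed_eq ?_ ?_
  · exact M.continuous.comp (T.continuous.comp (ContinuousLinearMap.apply ℂ H x).continuous)
  · exact (ContinuousLinearMap.apply ℂ H (T (N x))).continuous

variable [CompleteSpace H]

/-- The real orthogonal projection onto a standard subspace. -/
def proj (K : StandardSubspace H) : H →L[ℝ] H := K.toClosedSubmodule.toSubmodule.starProjection

theorem proj_mem (K : StandardSubspace H) (x : H) : K.proj x ∈ K.toClosedSubmodule :=
  Submodule.starProjection_apply_mem _ x

theorem inner_sub_proj (K : StandardSubspace H) (x : H) {y : H} (hy : y ∈ K.toClosedSubmodule) :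
    inner ℝ y (x - K.proj x) = 0 :=
  (Submodule.mem_orthogonal _ _).1 (Submodule.sub_starProjection_mem_orthogonal x) y hy

theorem proj_eq_of (K : StandardSubspace H) {x v : H} (hv : v ∈ K.toClosedSubmodule)
    (h : ∀ y ∈ K.toClosedSubmodule, inner ℝ y (x - v) = 0) : K.proj x = v :=
  Submodule.eq_starProjection_of_mem_orthogonal hv ((Submodule.mem_orthogonal _ _).2 h)

theorem proj_of_mem (K : StandardSubspace H) {x : H} (hx : x ∈ K.toClosedSubmodule) :
    K.proj x = x :=
  K.proj_eq_of hx fun y _ => by simp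

theorem proj_proj (K : StandardSubspace H) (x : H) : K.proj (K.proj x) = K.proj x :=
  K.proj_of_mem (K.proj_mem x)

/-- The projection formula `2 (1 + Δ_K)⁻¹ = P + Q`, with `P` and `Q` the real orthogonal
projections onto `K` and `iK`. -/
theorem two_smul_modularResolvent (K : StandardSubspace H) (x : H) :
    (2 : ℂ) • K.modularResolvent x = K.proj x - I • K.proj (I • x) := by
  set p := K.proj x with hp
  set q := K.proj (I • x) with hq
  have key : K.modularResolvent x = (1 / 2 : ℂ) • (p - I • q) := by
    rw [modularResolvent_eq_iff, modularOperator_graph]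
    -- As `p` and `q` lie in `K`, this is the image of `(p - iq)/2` under the Tomita operator. The
    -- adjoint condition is a combination of the orthogonality relations defining the projections
    -- `p` and `q`.
    refine ⟨(1 / 2 : ℂ) • (p + I • q), ?_, ?_⟩
    · rw [tomita_graph, mem_tomitaGraph]
      have e1 : (1 / 2 : ℂ) • (p - I • q) + (1 / 2 : ℂ) • (p + I • q) = p := by module
      have e2 : I • ((1 / 2 : ℂ) • (p - I • q) - (1 / 2 : ℂ) • (p + I • q)) = q := by
        have : I • ((1 / 2 : ℂ) • (p - I • q) - (1 / 2 : ℂ) • (p + I • q)) = (-(I * I)) • q := by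
          module
        rw [this, I_mul_I, neg_neg, one_smul]
      simp only [e1, e2]
      exact ⟨K.proj_mem _, K.proj_mem _⟩
    · rw [mem_tomita_adjoint_graph]
      intro a b hab
      rw [tomita_graph] at hab
      obtain ⟨ξ, hξ, η, hη, hab⟩ := hab
      obtain ⟨rfl, rfl⟩ := Prod.mk.inj hab
      have h1 := K.inner_sub_proj x hξ
      have h2 := K.inner_sub_proj (I • x) hη
      rw [← hp] at h1
      rw [← hq] at h2
      simp only [inner_real_eq_re_inner, inner_add_left, inner_sub_left, inner_add_right,
        inner_sub_right, inner_smul_left, inner_smul_right] at h1 h2 ⊢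
      simp at h1 h2 ⊢
      linarith
  rw [key, smul_smul]
  norm_num

/-- The bounded operator `i (1 - 2 (1 + Δ_K)⁻¹) = i (Δ_K - 1) (Δ_K + 1)⁻¹`. -/
def skew (K : StandardSubspace H) : H →L[ℂ] H := I • (1 - (2 : ℂ) • K.modularResolvent)

theorem skew_apply (K : StandardSubspace H) (x : H) :
    K.skew x = I • x - I • K.proj x - K.proj (I • x) := by
  change I • (x - (2 : ℂ) • K.modularResolvent x) = _
  rw [two_smul_modularResolvent, smul_sub, smul_sub, smul_smul, I_mul_I]
  module

/-- Both sides equal `-P(iPx)`. Invariance of `K` under its modular group comes from this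
cancellation. -/
theorem proj_skew (K : StandardSubspace H) (x : H) : K.proj (K.skew x) = K.skew (K.proj x) := by
  simp only [skew_apply, map_sub, proj_proj]
  abel

instance isStarNormal_modularResolvent (K : StandardSubspace H) :
    IsStarNormal K.modularResolvent :=
  K.modularResolvent_isPositive.isSelfAdjoint.isStarNormal

theorem skew_eq_cfc (K : StandardSubspace H) :
    K.skew = cfc (fun z : ℂ => I * (1 - 2 * z)) K.modularResolvent := by
  rw [cfc_const_mul _ _ _ (by fun_prop), cfc_sub _ _ _ (by fun_prop) (by fun_prop),
    cfc_const_mul _ _ _ (by fun_prop), cfc_id' ℂ K.modularResolvent,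
    cfc_const_one ℂ K.modularResolvent]
  rfl

theorem vanishesAtEnds_continuousOn_spectrum (K : StandardSubspace H) {f : ℝ → ℂ}
    (hf : VanishesAtEnds f) :
    ContinuousOn (fun z : ℂ => f (z.re⁻¹ - 1)) (spectrum ℂ K.modularResolvent) :=
  hf.continuousOn.mono fun _ hz => (K.modularResolvent_spectrum hz).2.1

/-- A real linear operator commuting with `i (Δ_K - 1) (Δ_K + 1)⁻¹` commutes with `f(Δ_K)` for
all `f` such that `f x⁻¹` is the conjugate of `f x`. -/
theorem apply_modularFunction_comm (K : StandardSubspace H) {T : H →L[ℝ] H}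
    (h : ∀ x, T (K.skew x) = K.skew (T x)) {f : ℝ → ℂ} (hf : VanishesAtEnds f)
    (hs : ∀ x, 0 < x → f x⁻¹ = (starRingEnd ℂ) (f x)) (x : H) :
    T (K.modularFunction f x) = K.modularFunction f (T x) := by
  have hcl := isClosed_apply_comm T 1 1
  suffices hm : K.modularFunction f ∈ {A : H →L[ℂ] H | ∀ x, (1 : H →L[ℂ] H) (T (A x)) =
      A (T ((1 : H →L[ℂ] H) x))} from hm x
  refine hcl.closure_subset (Metric.mem_closure_iff.2 fun ε hε => ?_)
  -- In the variable `u = 1 - 2b` on the spectrum of the resolvent, `skew` is `iu` and `Δ` is `(1 +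
  -- u)/(1 - u)`, so inversion of `Δ` becomes `u ↦ -u`.
  let g : ℝ → ℂ := fun u => f (((1 - u) / 2)⁻¹ - 1)
  have hgc : ContinuousOn g (Set.Icc (-1) 1) := by
    refine hf.continuousOn.comp (f := fun u : ℝ => (((1 - u) / 2 : ℝ) : ℂ)) (by fun_prop) ?_
    intro u hu
    change 0 ≤ (1 - u) / 2
    linarith [hu.2]
  have hgs : ∀ u ∈ Set.Icc (-1 : ℝ) 1, g (-u) = (starRingEnd ℂ) (g u) := by
    intro u hu
    -- At `u = -1` the argument of `f` is `0`, and at `u = 1` it is `0⁻¹ - 1 = -1` by the convention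
    -- for `0⁻¹`; `f` vanishes at both.
    rcases eq_or_lt_of_le hu.1 with rfl | h1
    · norm_num [g, hf.eq_zero]
    rcases eq_or_lt_of_le hu.2 with rfl | h2
    · norm_num [g, hf.eq_zero]
    have h3 : 0 < 1 - u := by linarith
    have h4 : 0 < 1 + u := by linarith
    have e : ((1 - u) / 2)⁻¹ - 1 = (1 + u) / (1 - u) := by field_simp; ring
    have e' : ((1 - -u) / 2)⁻¹ - 1 = ((1 + u) / (1 - u))⁻¹ := by
      rw [sub_neg_eq_add]; field_simp; ring
    simp only [g, e, e']
    exact hs _ (by positivity)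
  obtain ⟨q, hq⟩ := exists_real_polynomial_near hgc hgs (half_pos hε)
  refine ⟨aeval K.skew (q.map (algebraMap ℝ ℂ)), fun x => apply_aeval_comm h q x, ?_⟩
  rw [dist_comm, dist_eq_norm, skew_eq_cfc,
    ← cfc_map_polynomial _ _ _ (ha := K.isStarNormal_modularResolvent) (hf := by fun_prop),
    modularFunction, ← cfc_sub _ _ _ (by fun_prop) (K.vanishesAtEnds_continuousOn_spectrum hf)]
  refine (norm_cfc_le (half_pos hε).le fun z hz => ?_).trans_lt (half_lt_self hε)
  obtain ⟨hz, h0, h1⟩ := K.modularResolvent_spectrum hz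
  have := hq (1 - 2 * z.re) ⟨by linarith, by linarith⟩
  have e1 : I * (1 - 2 * z) = I * ((1 - 2 * z.re : ℝ) : ℂ) := by push_cast; rw [← hz]
  have e2 : f (z.re⁻¹ - 1) = g (1 - 2 * z.re) := by
    change _ = f _
    congr 3; ring
  rwa [e1, e2]

end StandardSubspace

end ModularTheory

/-! ### Invariance under the modular group, and rigidity of invariant subspaces. -/

noncomputable section ModularTheory

namespace StandardSubspace

open Complex ClosedSubmodule Polynomial
open scoped ComplexOrder ComplexInnerProductSpace InnerProduct

variable {H : Type*} [NormedAddCommGroup H] [InnerProductSpace ℂ H] [CompleteSpace H]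

theorem modularGroup_mul_modularFunction (K : StandardSubspace H) (t : ℝ) {f : ℝ → ℂ}
    (hf : VanishesAtEnds f) :
    K.modularGroup t * K.modularFunction f =
      K.modularFunction fun x => (x : ℂ) ^ (I * t) * f x :=
  K.modularGroup_spec t f hf

theorem eq_of_mul_bump_eq (K : StandardSubspace H) {V V' : H →L[ℂ] H}
    (h : V * K.modularFunction bump = V' * K.modularFunction bump) : V = V' := by
  ext x
  exact congrFun (K.modularFunction_bump_denseRange.equalizer V.continuous V'.continuous
    (funext fun y => congrArg (fun T : H →L[ℂ] H => T y) h)) x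

theorem eq_modularGroup (K : StandardSubspace H) {t : ℝ} {V : H →L[ℂ] H}
    (h : V * K.modularFunction bump = K.modularFunction fun x => (x : ℂ) ^ (I * t) * bump x) :
    V = K.modularGroup t :=
  K.eq_of_mul_bump_eq (h.trans (K.modularGroup_mul_modularFunction t bump_vanishesAtEnds).symm)

theorem modularGroup_zero (K : StandardSubspace H) : K.modularGroup 0 = 1 := by
  refine (K.eq_modularGroup ?_).symm
  rw [one_mul]
  congr 1
  funext x
  simp

theorem modularGroup_add (K : StandardSubspace H) (s t : ℝ) :
    K.modularGroup (s + t) = K.modularGroup s * K.modularGroup t := by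
  refine (K.eq_modularGroup ?_).symm
  rw [mul_assoc, modularGroup_mul_modularFunction _ _ bump_vanishesAtEnds,
    modularGroup_mul_modularFunction _ _ (bump_vanishesAtEnds.cpow_mul t)]
  congr 1
  funext x
  rcases le_or_gt x 0 with hx | hx
  · simp [bump, hx]
  · push_cast
    rw [mul_add, Complex.cpow_add _ _ (by exact_mod_cast hx.ne')]
    ring

theorem modularGroup_neg_mul (K : StandardSubspace H) (t : ℝ) :
    K.modularGroup (-t) * K.modularGroup t = 1 := by
  rw [← modularGroup_add, neg_add_cancel, modularGroup_zero]

theorem bump_inv {x : ℝ} (hx : 0 < x) : bump x⁻¹ = (starRingEnd ℂ) (bump x) := by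
  rw [bump, bump, if_neg (by simpa using hx), if_neg (by simpa using hx), conj_ofReal]
  congr 1
  field_simp
  ring

/-- Multiplying by `x^{it}` thus keeps the symmetry needed in `apply_modularFunction_comm`. -/
theorem cpow_I_inv {x : ℝ} (hx : 0 < x) (t : ℝ) :
    ((x⁻¹ : ℝ) : ℂ) ^ (I * t) = (starRingEnd ℂ) ((x : ℂ) ^ (I * t)) := by
  have harg : (x : ℂ).arg ≠ Real.pi := by
    rw [Complex.arg_ofReal_of_nonneg hx.le]; exact Real.pi_pos.ne
  push_cast
  rw [Complex.inv_cpow _ _ harg, ← Complex.cpow_neg]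
  have h := Complex.conj_cpow (x : ℂ) (-(I * t)) harg
  rw [conj_ofReal] at h
  rw [h]
  simp

/-- The modular group commutes with the real orthogonal projection, so that it maps `K`
onto itself. -/
theorem proj_modularGroup (K : StandardSubspace H) (t : ℝ) (x : H) :
    K.proj (K.modularGroup t x) = K.modularGroup t (K.proj x) := by
  have h1 := K.apply_modularFunction_comm K.proj_skew bump_vanishesAtEnds fun x hx => bump_inv hx
  have h2 := K.apply_modularFunction_comm K.proj_skew (bump_vanishesAtEnds.cpow_mul t)
    fun x hx => by rw [bump_inv hx, cpow_I_inv hx, map_mul]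
  have h3 : ∀ y, K.modularGroup t (K.modularFunction bump y) =
      K.modularFunction (fun x => (x : ℂ) ^ (I * t) * bump x) y := fun y =>
    congrArg (fun T : H →L[ℂ] H => T y)
      (K.modularGroup_mul_modularFunction t bump_vanishesAtEnds)
  refine congrFun (K.modularFunction_bump_denseRange.equalizer
    (g := fun x => K.proj (K.modularGroup t x)) (h := fun x => K.modularGroup t (K.proj x))
    (by fun_prop) (by fun_prop) (funext fun y => ?_)) x
  simp only [Function.comp_apply]
  rw [h3, h2, h1, h3]

theorem VanishesAtEnds.const_mul_sub {f g : ℝ → ℂ} (hf : VanishesAtEnds f)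
    (hg : VanishesAtEnds g) (c : ℂ) : VanishesAtEnds fun x => c * (f x - g x) := by
  refine ⟨?_, fun x hx => by simp [hf.eq_zero x hx, hg.eq_zero x hx], ?_⟩
  · have := hf.continuous
    have := hg.continuous
    fun_prop
  · simpa using (hf.tendsto.sub hg.tendsto).const_mul c

/-- The operator `i sin (s log Δ_K)`. -/
def modularSine (K : StandardSubspace H) (s : ℝ) : H →L[ℂ] H :=
  (1 / 2 : ℂ) • (K.modularGroup s - K.modularGroup (-s))

theorem cpow_I_eq_exp {x : ℝ} (hx : 0 < x) (s : ℝ) :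
    (x : ℂ) ^ (I * s) = Complex.exp ((s * Real.log x : ℝ) * I) := by
  rw [Complex.cpow_def_of_ne_zero (by exact_mod_cast hx.ne'), ← Complex.ofReal_log hx.le]
  congr 1
  push_cast
  ring

/-- Vanishing at the ends is proved along with the identity so that both can be iterated over powers
of the sine. -/
theorem modularSine_mul_modularFunction (K : StandardSubspace H) (s : ℝ) {f : ℝ → ℂ}
    (hf : VanishesAtEnds f) :
    VanishesAtEnds (fun x => I * (Real.sin (s * Real.log x) : ℂ) * f x) ∧
      K.modularSine s * K.modularFunction f =
        K.modularFunction fun x => I * (Real.sin (s * Real.log x) : ℂ) * f x := by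
  have e : (fun x : ℝ => I * (Real.sin (s * Real.log x) : ℂ) * f x) = fun x : ℝ =>
      (1 / 2 : ℂ) * ((x : ℂ) ^ (I * s) * f x - (x : ℂ) ^ (I * (-s : ℝ)) * f x) := by
    funext x
    rcases le_or_gt x 0 with hx | hx
    · simp [hf.eq_zero x hx]
    · rw [cpow_I_eq_exp hx, cpow_I_eq_exp hx, Complex.ofReal_sin, Complex.sin]
      have h1 : ((-s * Real.log x : ℝ) : ℂ) * I = -((s * Real.log x : ℝ) : ℂ) * I := by
        push_cast; ring
      rw [h1]
      linear_combination (1 / 2 : ℂ) * f x * (Complex.exp (-((s * Real.log x : ℝ) : ℂ) * I) -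
        Complex.exp (((s * Real.log x : ℝ) : ℂ) * I)) * I_mul_I
  rw [e]
  have hv := hf.cpow_mul s
  have hv' := hf.cpow_mul (-s)
  refine ⟨hv.const_mul_sub hv' _, ?_⟩
  rw [modularSine, smul_mul_assoc, sub_mul, modularGroup_mul_modularFunction _ _ hf,
    modularGroup_mul_modularFunction _ _ hf]
  have h1 := K.vanishesAtEnds_continuousOn_spectrum hv
  have h2 := K.vanishesAtEnds_continuousOn_spectrum hv'
  simp only [modularFunction]
  rw [← cfc_sub _ _ _ h1 h2]
  exact (cfc_const_mul _ _ _ (h1.sub h2)).symm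

theorem aeval_modularSine_mul_modularFunction (K : StandardSubspace H) (s : ℝ) (q : ℂ[X])
    {f : ℝ → ℂ} (hf : VanishesAtEnds f) :
    VanishesAtEnds (fun x => q.eval (I * (Real.sin (s * Real.log x) : ℂ)) * f x) ∧
      aeval (K.modularSine s) q * K.modularFunction f =
        K.modularFunction fun x => q.eval (I * (Real.sin (s * Real.log x) : ℂ)) * f x := by
  induction q using Polynomial.induction_on with
  | C c =>
    have hc : VanishesAtEnds fun x => c * f x := by
      simpa [VanishesAtEnds] using hf.const_mul_sub
        (g := fun _ => 0) ⟨continuous_const, fun _ _ => rfl, tendsto_const_nhds⟩ c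
    simp only [eval_C, aeval_C]
    refine ⟨hc, ?_⟩
    rw [modularFunction, modularFunction,
      cfc_const_mul _ _ _ (K.vanishesAtEnds_continuousOn_spectrum hf), Algebra.smul_def]
  | add p q hp hq =>
    simp only [eval_add, add_mul, map_add]
    refine ⟨?_, ?_⟩
    · refine ⟨hp.1.continuous.add hq.1.continuous, fun x hx => ?_, ?_⟩
      · rw [hp.1.eq_zero x hx, hq.1.eq_zero x hx, add_zero]
      · simpa using hp.1.tendsto.add hq.1.tendsto
    · rw [hp.2, hq.2]
      simp only [modularFunction]
      rw [cfc_add _ _ _ (K.vanishesAtEnds_continuousOn_spectrum hp.1)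
        (K.vanishesAtEnds_continuousOn_spectrum hq.1)]
  | monomial n c h =>
    obtain ⟨h1, h2⟩ := K.modularSine_mul_modularFunction s h.1
    have e : (fun x : ℝ => (Polynomial.C c * X ^ (n + 1)).eval
          (I * (Real.sin (s * Real.log x) : ℂ)) * f x) =
        fun x => I * (Real.sin (s * Real.log x) : ℂ) *
          ((Polynomial.C c * X ^ n).eval (I * (Real.sin (s * Real.log x) : ℂ)) * f x) := by
      funext x
      simp only [eval_mul, eval_C, eval_pow, eval_X]
      ring
    rw [e]
    refine ⟨h1, ?_⟩
    rw [← h2, ← h.2, ← mul_assoc]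
    congr 1
    rw [pow_succ', ← mul_assoc, mul_comm (Polynomial.C c) X, mul_assoc, map_mul, aeval_X]

theorem norm_modularFunction_sub_le (K : StandardSubspace H) {f g : ℝ → ℂ}
    (hf : VanishesAtEnds f) (hg : VanishesAtEnds g) {ε : ℝ} (hε : 0 ≤ ε)
    (h : ∀ x, 0 < x → ‖f x - g x‖ ≤ ε) :
    ‖K.modularFunction f - K.modularFunction g‖ ≤ ε := by
  rw [modularFunction, modularFunction, ← cfc_sub _ _ _ (K.vanishesAtEnds_continuousOn_spectrum hf)
    (K.vanishesAtEnds_continuousOn_spectrum hg)]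
  refine norm_cfc_le hε fun z _ => ?_
  rcases le_or_gt (z.re⁻¹ - 1) 0 with hx | hx
  · rwa [hf.eq_zero _ hx, hg.eq_zero _ hx, sub_zero, norm_zero]
  · exact h _ hx

theorem halfTanh_mul_bump_vanishesAtEnds :
    VanishesAtEnds fun x => I * (halfTanh (Real.log x) : ℂ) * bump x := by
  have hb := bump_vanishesAtEnds
  have hle : ∀ y, |halfTanh y| ≤ 1 := by
    intro y
    have := Real.exp_pos y
    rw [halfTanh, abs_div, abs_of_pos (by positivity : 0 < Real.exp y + 1),
      div_le_one (by positivity), abs_le]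
    constructor <;> linarith
  have hn : ∀ x, ‖I * (halfTanh (Real.log x) : ℂ) * bump x‖ ≤ ‖bump x‖ := by
    intro x
    rw [norm_mul, norm_mul, norm_I, one_mul, Complex.norm_real]
    exact mul_le_of_le_one_left (norm_nonneg _) (hle _)
  refine ⟨continuous_iff_continuousAt.2 fun x => ?_, fun x hx => by simp [hb.eq_zero x hx],
    squeeze_zero_norm hn (by simpa using hb.tendsto.norm)⟩
  rcases le_or_gt x 0 with hx | hx
  · have hz := hb.eq_zero x hx
    rw [ContinuousAt, hz, mul_zero]
    refine squeeze_zero_norm hn ?_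
    have := hb.continuous.norm.tendsto x
    rwa [hz, norm_zero] at this
  · have h1 : ContinuousAt (fun x => halfTanh (Real.log x)) x :=
      continuous_halfTanh.continuousAt.comp (Real.continuousAt_log hx.ne')
    exact (continuousAt_const.mul (Complex.continuous_ofReal.continuousAt.comp h1)).mul
      hb.continuous.continuousAt

/-- With `x = b⁻¹ - 1`, one has `tanh(log x / 2) = (x - 1)/(x + 1) = 1 - 2b`. -/
theorem skew_mul_bump (K : StandardSubspace H) :
    K.skew * K.modularFunction bump =
      K.modularFunction fun x => I * (halfTanh (Real.log x) : ℂ) * bump x := by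
  rw [skew_eq_cfc, modularFunction, modularFunction, ← cfc_mul _ _ _ (by fun_prop)
    (K.vanishesAtEnds_continuousOn_spectrum bump_vanishesAtEnds)]
  refine cfc_congr fun z hz => ?_
  obtain ⟨hz, h0, h1⟩ := K.modularResolvent_spectrum hz
  obtain ⟨b, rfl⟩ : ∃ b : ℝ, z = b := ⟨_, hz⟩
  simp only [Complex.ofReal_re] at h0 h1 ⊢
  rcases le_or_gt (b⁻¹ - 1) 0 with hx | hx
  · simp [bump, hx]
  · have hb : b ≠ 0 := by rintro rfl; norm_num at hx
    rw [halfTanh_log hx, show (b⁻¹ - 1 - 1) / (b⁻¹ - 1 + 1) = 1 - 2 * b by field_simp; ring]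
    push_cast
    rfl

theorem norm_bump {x : ℝ} (hx : 0 < x) : ‖bump x‖ = x / (1 + x) ^ 2 := by
  rw [bump, if_neg (not_le.2 hx), Complex.norm_real, Real.norm_of_nonneg (by positivity)]

theorem commute_modularFunction_bump_modularGroup (K : StandardSubspace H) (t : ℝ) :
    Commute (K.modularFunction bump) (K.modularGroup t) := by
  refine K.eq_of_mul_bump_eq ?_
  rw [mul_assoc, mul_assoc, modularGroup_mul_modularFunction _ _ bump_vanishesAtEnds,
    ← modularFunction_mul _ bump_vanishesAtEnds (bump_vanishesAtEnds.cpow_mul t),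
    ← modularFunction_mul _ bump_vanishesAtEnds bump_vanishesAtEnds,
    modularGroup_mul_modularFunction _ _ ?_]
  · congr 1; funext x; ring
  · refine ⟨bump_vanishesAtEnds.continuous.mul bump_vanishesAtEnds.continuous,
      fun x hx => by simp [bump, hx], ?_⟩
    simpa using bump_vanishesAtEnds.tendsto.mul bump_vanishesAtEnds.tendsto

theorem modularFunction_bump_injective (K : StandardSubspace H) {x : H}
    (hx : K.modularFunction bump x = 0) : x = 0 := by
  have hsa : IsSelfAdjoint (K.modularFunction bump) := by
    rw [modularFunction_bump]
    have h := K.modularResolvent_isPositive.isSelfAdjoint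
    exact (h.commute_iff ((IsSelfAdjoint.one _).sub h)).1
      ((Commute.one_right _).sub_right (Commute.refl _))
  refine K.modularFunction_bump_denseRange.eq_zero_of_inner_right ℂ ?_
  intro y
  have := hsa.isSymmetric y x
  simp only [ContinuousLinearMap.coe_coe] at this
  rw [this, hx, inner_zero_right]

/-- A real linear operator commuting with the modular group commutes with
`i (Δ_K - 1) (Δ_K + 1)⁻¹`. -/
theorem apply_skew_comm_of_modularGroup (K : StandardSubspace H) {T : H →L[ℝ] H}
    (h : ∀ t x, T (K.modularGroup t x) = K.modularGroup t (T x)) (x : H) :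
    T (K.skew x) = K.skew (T x) := by
  set M := K.modularFunction bump with hM
  have hcl := isClosed_apply_comm T M M
  -- `T` is not yet known to commute with `M`. For `A = pM`, with `p` a real polynomial in the sine,
  -- both sides are nevertheless `pMTMx`, since `p` commutes with `T` and with `M`; such `A`
  -- approximate `skew * M` in norm.
  have hmem : K.skew * M ∈ {A : H →L[ℂ] H | ∀ x, M (T (A x)) = A (T (M x))} := by
    refine hcl.closure_subset (Metric.mem_closure_iff.2 fun ε hε => ?_)
    -- One third of `ε` pays for replacing `log` by `sin(s log)/s`, another for the polynomial, and
    -- the last keeps the inequality strict.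
    obtain ⟨s, hs, hsε⟩ : ∃ s : ℝ, 0 < s ∧ s ^ 2 ≤ ε / 3 :=
      ⟨√(ε / 3), by positivity, (Real.sq_sqrt (by positivity)).le⟩
    obtain ⟨q, hq⟩ := exists_real_polynomial_near (h := fun u => I * (halfTanh (u / s) : ℂ))
      (by have := continuous_halfTanh; fun_prop)
      (fun u _ => by simp [neg_div, halfTanh_neg]) (show 0 < ε / 3 by positivity)
    obtain ⟨hv, he⟩ := K.aeval_modularSine_mul_modularFunction s (q.map (algebraMap ℝ ℂ))
      bump_vanishesAtEnds
    refine ⟨aeval (K.modularSine s) (q.map (algebraMap ℝ ℂ)) * M, ?_, ?_⟩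
    · have hT := fun x => apply_aeval_comm (T := T) (A := K.modularSine s) (fun x => by
        change T ((1 / 2 : ℂ) • (K.modularGroup s x - K.modularGroup (-s) x)) =
          (1 / 2 : ℂ) • (K.modularGroup s (T x) - K.modularGroup (-s) (T x))
        rw [← h, ← h, ← map_sub]
        have e : (1 / 2 : ℂ) = ((1 / 2 : ℝ) : ℂ) := by norm_num
        rw [e, Complex.coe_smul, Complex.coe_smul, map_smul]) q x
      have hc := apply_aeval_comm (T := M.restrictScalars ℝ) (A := K.modularSine s) (fun x =>
        congrArg (fun A : H →L[ℂ] H => A x)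
          (((K.commute_modularFunction_bump_modularGroup s).sub_right
          (K.commute_modularFunction_bump_modularGroup (-s))).smul_right (1 / 2 : ℂ)).eq) q
      intro x
      simp only [mul_apply_eq_comp]
      rw [hT]
      exact hc _
    · rw [dist_comm, dist_eq_norm, skew_mul_bump, he]
      refine (K.norm_modularFunction_sub_le hv halfTanh_mul_bump_vanishesAtEnds
        (ε := 2 * (ε / 3)) (by positivity) fun x hx => ?_).trans_lt (by linarith)
      have h1 := hq (Real.sin (s * Real.log x)) ⟨Real.neg_one_le_sin _, Real.sin_le_one _⟩
      have h2 := abs_halfTanh_sin_sub_mul_le hs hx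
      have h3 : x / (1 + x) ^ 2 ≤ 1 := by rw [div_le_one (by positivity)]; nlinarith
      have h4 : 0 ≤ x / (1 + x) ^ 2 := by positivity
      rw [← sub_mul, norm_mul, norm_bump hx]
      set Q := (q.map (algebraMap ℝ ℂ)).eval (I * (Real.sin (s * Real.log x) : ℂ))
      set a := halfTanh (Real.sin (s * Real.log x) / s)
      set b := halfTanh (Real.log x)
      have h5 : ‖Q - I * (b : ℂ)‖ ≤ ‖Q - I * (a : ℂ)‖ + |a - b| := by
        have : Q - I * (b : ℂ) = (Q - I * (a : ℂ)) + I * ((a - b : ℝ) : ℂ) := by push_cast; ring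
        rw [this]
        refine (norm_add_le _ _).trans_eq ?_
        rw [norm_mul, norm_I, one_mul, Complex.norm_real, Real.norm_eq_abs]
      calc _ ≤ (‖Q - I * (a : ℂ)‖ + |a - b|) * (x / (1 + x) ^ 2) := by gcongr
        _ = ‖Q - I * (a : ℂ)‖ * (x / (1 + x) ^ 2) + |a - b| * (x / (1 + x) ^ 2) := by ring
        _ ≤ ε / 3 * 1 + s ^ 2 := by gcongr
        _ ≤ _ := by linarith
  have hskew : Commute K.skew M := by
    rw [hM, modularFunction_bump, skew]
    refine Commute.smul_left ?_ _
    have hB := Commute.refl K.modularResolvent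
    refine ((Commute.one_left _).mul_right ((Commute.one_left _).sub_right
      (Commute.one_left _))).sub_left (Commute.smul_left ?_ _)
    exact hB.mul_right ((Commute.one_right _).sub_right hB)
  refine congrFun (K.modularFunction_bump_denseRange.equalizer
    (g := fun x => T (K.skew x)) (h := fun x => K.skew (T x))
    (by fun_prop) (by fun_prop) (funext fun y => ?_)) x
  simp only [Function.comp_apply]
  -- Injectivity of `M` removes the factor on the left, and its dense range has already removed the
  -- one on the right.
  refine sub_eq_zero.1 (K.modularFunction_bump_injective ?_)
  rw [map_sub, sub_eq_zero, ← hM]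
  have h1 := hmem y
  simp only [mul_apply_eq_comp] at h1
  rw [h1]
  exact congrArg (fun A : H →L[ℂ] H => A (T (M y))) hskew.eq

/-- A cyclic closed real subspace of `K` that is invariant under the modular group of `K`
is equal to `K`. -/
theorem eq_of_le_of_modularGroup_invariant {K L : StandardSubspace H}
    (hle : L.toClosedSubmodule ≤ K.toClosedSubmodule)
    (h : ∀ t x, L.proj (K.modularGroup t x) = K.modularGroup t (L.proj x)) : L = K := by
  have hC := K.apply_skew_comm_of_modularGroup h
  refine toClosedSubmodule_inj.1 (le_antisymm hle fun η hη => ?_)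
  -- It suffices that `K` contains no nonzero vector orthogonal to `L`, as `η - L.proj η` is such a
  -- vector.
  have key : ∀ ζ ∈ K.toClosedSubmodule, L.proj ζ = 0 → ζ = 0 := by
    intro ζ hζ h0
    have hre : ∀ ξ ∈ L.toClosedSubmodule, inner ℝ ξ ζ = 0 := by
      intro ξ hξ
      simpa [h0] using L.inner_sub_proj ζ hξ
    have him : ∀ ξ ∈ L.toClosedSubmodule, inner ℝ (I • ξ) ζ = 0 := by
      intro ξ hξ
      -- For `ξ ∈ L ⊆ K` this puts `skew ξ = -P(iξ)` in `L`. Hence `ζ` is orthogonal to `P(iξ)`,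
      -- and, lying in `K`, also to `iξ`.
      have h1 : L.proj (K.skew ξ) = K.skew ξ := by rw [hC, L.proj_of_mem hξ]
      have h2 := hre (K.skew ξ) (h1 ▸ L.proj_mem _)
      rw [skew_apply, K.proj_of_mem (hle hξ), sub_self, zero_sub, inner_neg_left, neg_eq_zero,
        real_inner_comm] at h2
      have h3 := K.inner_sub_proj (I • ξ) hζ
      rw [inner_sub_right, h2, sub_zero] at h3
      rw [real_inner_comm, h3]
    -- Orthogonality to `iL` is membership in `L'`, and orthogonality to `L` is membership in `iL'`;
    -- their intersection is zero because `L` is cyclic.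
    have hsep := L.symplComp.IsSeparating
    have hmem : ζ ∈ L.symplComp.toClosedSubmodule ⊓ L.symplComp.toClosedSubmodule.mulI := by
      refine ⟨mem_symplComp_iff.2 fun ξ hξ => ?_, ?_⟩
      · have := him ξ hξ
        simpa [inner_real_eq_re_inner, inner_smul_left] using this
      · change ζ ∈ L.symplComp.toClosedSubmodule.mulI
        rw [mem_mapEquiv_iff, scalarSMulCLE_symm_apply]
        refine mem_symplComp_iff.2 fun ξ hξ => ?_
        have := hre ξ hξ
        simpa [inner_real_eq_re_inner, Units.smul_def, inner_smul_right] using this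
    rw [hsep] at hmem
    simpa using hmem
  have := key (η - L.proj η)
    (K.toClosedSubmodule.toSubmodule.sub_mem hη (hle (L.proj_mem η)))
    (by rw [map_sub, proj_proj, sub_self])
  rw [sub_eq_zero.1 this]
  exact L.proj_mem η

end StandardSubspace

end ModularTheory

/-! ### Symplectic complements and unitary covariance of modular objects. -/

noncomputable section ModularTheory

namespace StandardSubspace

open Complex ClosedSubmodule
open scoped ComplexOrder ComplexInnerProductSpace InnerProduct

variable {H : Type*} [NormedAddCommGroup H] [InnerProductSpace ℂ H] [CompleteSpace H]

/-- `K'` is the real orthogonal complement of `iK`, and the projection onto `iK` is `x ↦ -iP(ix)`.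
-/
theorem proj_symplComp (K : StandardSubspace H) (x : H) :
    K.symplComp.proj x = x + I • K.proj (I • x) := by
  refine K.symplComp.proj_eq_of (mem_symplComp_iff.2 fun y hy => ?_) fun y hy => ?_
  · have := K.inner_sub_proj (I • x) hy
    simp only [inner_real_eq_re_inner, inner_sub_right, inner_add_right, inner_smul_right] at this ⊢
    simp at this ⊢
    linarith
  · have := mem_symplComp_iff.1 hy _ (K.proj_mem (I • x))
    rw [sub_add_cancel_left, inner_neg_right, neg_eq_zero, inner_real_eq_re_inner,
      inner_smul_right]
    have e : (⟪y, K.proj (I • x)⟫).im = -(⟪K.proj (I • x), y⟫).im := inner_im_symm (𝕜 := ℂ) _ _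
    simp [e, this]

/-- The projections onto `K'` and `iK'` are `1 - Q` and `1 - P`, so the projection formula gives `2
- (P + Q)`. In terms of modular operators, `Δ_{K'} = Δ_K⁻¹`. -/
theorem modularResolvent_symplComp (K : StandardSubspace H) :
    K.symplComp.modularResolvent = 1 - K.modularResolvent := by
  ext x
  have h1 := K.symplComp.two_smul_modularResolvent x
  have h2 := K.two_smul_modularResolvent x
  have hI : I • I • x = -x := by rw [smul_smul, I_mul_I, neg_one_smul]
  rw [proj_symplComp, proj_symplComp, hI, map_neg, smul_add, hI] at h1
  have h3 : (2 : ℂ) • K.symplComp.modularResolvent x = (2 : ℂ) • (x - K.modularResolvent x) := by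
    rw [h1, smul_sub, h2, smul_neg, smul_neg, smul_smul, I_mul_I]
    module
  exact smul_right_injective H (two_ne_zero (α := ℂ)) h3

theorem modularFunction_symplComp (K : StandardSubspace H) {f : ℝ → ℂ} (hf : VanishesAtEnds f) :
    K.symplComp.modularFunction f = K.modularFunction fun x => f x⁻¹ := by
  have h1 : (1 : H →L[ℂ] H) - K.modularResolvent =
      cfc (fun z : ℂ => 1 - z) K.modularResolvent := by
    rw [cfc_sub _ _ _ (by fun_prop) (by fun_prop), cfc_id' ℂ K.modularResolvent,
      cfc_const_one ℂ K.modularResolvent]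
  have hc : ContinuousOn (fun z : ℂ => f (z.re⁻¹ - 1))
      ((fun z : ℂ => 1 - z) '' spectrum ℂ K.modularResolvent) := by
    refine hf.continuousOn.mono ?_
    rintro _ ⟨z, hz, rfl⟩
    have := (K.modularResolvent_spectrum hz).2.2
    simpa using this
  rw [modularFunction, modularFunction, modularResolvent_symplComp, h1,
    ← cfc_comp _ _ _ (hf := by fun_prop) (hg := hc)]
  refine cfc_congr fun z hz => ?_
  obtain ⟨-, h0, h1⟩ := K.modularResolvent_spectrum hz
  simp only [Function.comp_apply, sub_re, one_re]
  generalize z.re = b at h0 h1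
  -- At the endpoints `b = 0` and `b = 1` the conventions for `0⁻¹` make the arguments of `f` equal
  -- to `0` or `-1`, where `f` vanishes.
  rcases eq_or_lt_of_le h0 with rfl | h0
  · rw [hf.eq_zero _ (by norm_num), hf.eq_zero _ (by norm_num)]
  rcases eq_or_lt_of_le h1 with rfl | h1
  · rw [hf.eq_zero _ (by norm_num), hf.eq_zero _ (by norm_num)]
  have h2 : 1 - b ≠ 0 := by linarith
  congr 1
  rw [show b⁻¹ - 1 = (1 - b) / b by field_simp, inv_div]
  field_simp
  ring

/-- `Δ_{K'}^{it} = Δ_K^{-it}`. -/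
theorem modularGroup_symplComp (K : StandardSubspace H) (t : ℝ) :
    K.symplComp.modularGroup t = K.modularGroup (-t) := by
  refine (K.symplComp.eq_modularGroup ?_).symm
  rw [modularFunction_symplComp _ bump_vanishesAtEnds,
    modularFunction_symplComp _ (bump_vanishesAtEnds.cpow_mul t)]
  have hb : (fun x => bump x⁻¹) = bump := by
    funext x
    rcases le_or_gt x 0 with hx | hx
    · rw [bump_vanishesAtEnds.eq_zero _ hx, bump_vanishesAtEnds.eq_zero _ (inv_nonpos.2 hx)]
    · rw [bump_inv hx, bump, if_neg (not_le.2 hx), conj_ofReal]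
  have hb' : ∀ x : ℝ, bump x⁻¹ = bump x := fun x => congrFun hb x
  simp only [hb']
  rw [modularGroup_mul_modularFunction _ _ bump_vanishesAtEnds]
  congr 1
  funext x
  rcases le_or_gt x 0 with hx | hx
  · simp [bump, hx]
  · rw [cpow_I_eq_exp hx, cpow_I_eq_exp (inv_pos.2 hx), Real.log_inv]
    simp

theorem unitary_inner (u : unitary (H →L[ℂ] H)) (x y : H) :
    ⟪(u : H →L[ℂ] H) x, (u : H →L[ℂ] H) y⟫ = ⟪x, y⟫ := by
  rw [← ContinuousLinearMap.adjoint_inner_right, ← ContinuousLinearMap.star_eq_adjoint,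
    ← mul_apply_eq_comp, Unitary.star_mul_self_of_mem u.2]
  rfl

/-- The unitary `u` maps `K` onto `L`. -/
def MapsOnto (u : unitary (H →L[ℂ] H)) (K L : StandardSubspace H) : Prop :=
  (u : H →L[ℂ] H) '' (K.toClosedSubmodule : Set H) = L.toClosedSubmodule

/-- Covariance starts from the projection, because the resolvent, its functions and the modular
group are all recovered from it. -/
theorem MapsOnto.proj {u : unitary (H →L[ℂ] H)} {K L : StandardSubspace H} (h : MapsOnto u K L)
    (x : H) : L.proj ((u : H →L[ℂ] H) x) = (u : H →L[ℂ] H) (K.proj x) := by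
  refine L.proj_eq_of ?_ fun y hy => ?_
  · have : (u : H →L[ℂ] H) (K.proj x) ∈ (L.toClosedSubmodule : Set H) := h ▸ ⟨_, K.proj_mem x, rfl⟩
    exact this
  · have hy' : y ∈ (L.toClosedSubmodule : Set H) := hy
    rw [← h] at hy'
    obtain ⟨z, hz, rfl⟩ := hy'
    rw [← map_sub, inner_real_eq_re_inner, unitary_inner]
    exact K.inner_sub_proj x hz

theorem MapsOnto.modularResolvent {u : unitary (H →L[ℂ] H)} {K L : StandardSubspace H}
    (h : MapsOnto u K L) :
    L.modularResolvent = (u : H →L[ℂ] H) * K.modularResolvent * (star u : unitary (H →L[ℂ] H)) := by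
  have key : L.modularResolvent * (u : H →L[ℂ] H) = (u : H →L[ℂ] H) * K.modularResolvent := by
    ext x
    refine smul_right_injective H (two_ne_zero (α := ℂ)) ?_
    simp only [mul_apply_eq_comp]
    rw [two_smul_modularResolvent, ← map_smul (u : H →L[ℂ] H) I, h.proj, h.proj,
      ← map_smul (u : H →L[ℂ] H) 2, two_smul_modularResolvent, map_sub,
      map_smul (u : H →L[ℂ] H)]
  rw [← key, mul_assoc, Unitary.coe_star, Unitary.mul_star_self_of_mem u.2, mul_one]

theorem MapsOnto.modularFunction {u : unitary (H →L[ℂ] H)} {K L : StandardSubspace H}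
    (h : MapsOnto u K L) {f : ℝ → ℂ} (hf : VanishesAtEnds f) :
    L.modularFunction f * (u : H →L[ℂ] H) = (u : H →L[ℂ] H) * K.modularFunction f := by
  have hφ : Continuous (Unitary.conjStarAlgAut ℂ (H →L[ℂ] H) u) := by
    have : ⇑(Unitary.conjStarAlgAut ℂ (H →L[ℂ] H) u) = fun A : H →L[ℂ] H =>
      (u : H →L[ℂ] H) * A * (star u : unitary (H →L[ℂ] H)) := by
      funext A; simp [Unitary.conjStarAlgAut_apply]
    rw [this]
    fun_prop
  have hB : Unitary.conjStarAlgAut ℂ (H →L[ℂ] H) u K.modularResolvent = L.modularResolvent := by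
    rw [h.modularResolvent]; simp [Unitary.conjStarAlgAut_apply]
  have key := StarAlgHomClass.map_cfc (S := ℂ) (Unitary.conjStarAlgAut ℂ (H →L[ℂ] H) u)
    (fun z : ℂ => f (z.re⁻¹ - 1)) K.modularResolvent
    (hf := K.vanishesAtEnds_continuousOn_spectrum hf) (hφ := hφ)
    (ha := K.isStarNormal_modularResolvent) (hφa := hB ▸ L.isStarNormal_modularResolvent)
  rw [hB] at key
  rw [StandardSubspace.modularFunction, ← key, Unitary.conjStarAlgAut_apply, mul_assoc,
    Unitary.star_mul_self_of_mem u.2, mul_one]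
  rfl

/-- `u Δ_K^{it} = Δ_{uK}^{it} u`. -/
theorem MapsOnto.modularGroup {u : unitary (H →L[ℂ] H)} {K L : StandardSubspace H}
    (h : MapsOnto u K L) (t : ℝ) :
    L.modularGroup t * (u : H →L[ℂ] H) = (u : H →L[ℂ] H) * K.modularGroup t := by
  refine K.eq_of_mul_bump_eq ?_
  rw [mul_assoc, mul_assoc, ← h.modularFunction bump_vanishesAtEnds,
    modularGroup_mul_modularFunction _ _ bump_vanishesAtEnds,
    ← h.modularFunction (bump_vanishesAtEnds.cpow_mul t), ← mul_assoc,
    modularGroup_mul_modularFunction _ _ bump_vanishesAtEnds]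

theorem MapsOnto.symplComp {u : unitary (H →L[ℂ] H)} {K L : StandardSubspace H}
    (h : MapsOnto u K L) : MapsOnto u K.symplComp L.symplComp := by
  have hu : ∀ x, (u : H →L[ℂ] H) (((star u : unitary (H →L[ℂ] H)) : H →L[ℂ] H) x) = x := fun x => by
    rw [← mul_apply_eq_comp, Unitary.coe_star, Unitary.mul_star_self_of_mem u.2]; rfl
  ext x
  constructor
  · rintro ⟨x, hx, rfl⟩
    refine mem_symplComp_iff.2 fun y hy => ?_
    have hy' : y ∈ (L.toClosedSubmodule : Set H) := hy
    rw [← h] at hy'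
    obtain ⟨z, hz, rfl⟩ := hy'
    rw [unitary_inner]
    exact mem_symplComp_iff.1 hx z hz
  · intro hx
    refine ⟨((star u : unitary (H →L[ℂ] H)) : H →L[ℂ] H) x, mem_symplComp_iff.2 fun y hy => ?_, hu x⟩
    rw [← unitary_inner u, hu]
    have : (u : H →L[ℂ] H) y ∈ (L.toClosedSubmodule : Set H) := h ▸ ⟨_, hy, rfl⟩
    exact mem_symplComp_iff.1 hx _ this

end StandardSubspace

end ModularTheory

/-! ### Lorentz geometry: wedge stabilizers and boosts. -/

noncomputable section Minkowski

open Matrix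
open scoped Pointwise

theorem lorentzMatrix_transpose_mul (Λ : properLorentz) :
    (lorentzMatrix Λ)ᵀ * minkowskiMetric * lorentzMatrix Λ = minkowskiMetric :=
  (Λ : lorentzGroup).2

theorem minkowskiMetric_mul_self : minkowskiMetric * minkowskiMetric = 1 := by
  ext i j
  fin_cases i <;> fin_cases j <;> simp [minkowskiMetric]

theorem lorentzMatrix_inv (Λ : properLorentz) :
    lorentzMatrix Λ⁻¹ = minkowskiMetric * (lorentzMatrix Λ)ᵀ * minkowskiMetric := by
  have h1 : minkowskiMetric * (lorentzMatrix Λ)ᵀ * minkowskiMetric * lorentzMatrix Λ = 1 := by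
    rw [Matrix.mul_assoc, Matrix.mul_assoc, ← Matrix.mul_assoc _ minkowskiMetric,
      lorentzMatrix_transpose_mul, minkowskiMetric_mul_self]
  have h2 : lorentzMatrix Λ * lorentzMatrix Λ⁻¹ = 1 := by
    rw [← lorentzMatrix_mul, mul_inv_cancel, lorentzMatrix_one]
  calc lorentzMatrix Λ⁻¹ = minkowskiMetric * (lorentzMatrix Λ)ᵀ * minkowskiMetric *
        lorentzMatrix Λ * lorentzMatrix Λ⁻¹ := by rw [h1, Matrix.one_mul]
    _ = _ := by rw [Matrix.mul_assoc _ (lorentzMatrix Λ), h2, Matrix.mul_one]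

theorem lorentzMatrix_inv_apply (Λ : properLorentz) (i j : Fin 4) :
    lorentzMatrix Λ⁻¹ i j =
      (![1, -1, -1, -1] : Fin 4 → ℝ) i * lorentzMatrix Λ j i * (![1, -1, -1, -1] : Fin 4 → ℝ) j := by
  rw [lorentzMatrix_inv, minkowskiMetric, Matrix.mul_diagonal, Matrix.diagonal_mul,
    Matrix.transpose_apply]

theorem lorentzMatrix_column_product (Λ : properLorentz) (i j : Fin 4) :
    lorentzMatrix Λ 0 i * lorentzMatrix Λ 0 j - lorentzMatrix Λ 1 i * lorentzMatrix Λ 1 j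
      - lorentzMatrix Λ 2 i * lorentzMatrix Λ 2 j - lorentzMatrix Λ 3 i * lorentzMatrix Λ 3 j
      = minkowskiMetric i j := by
  rw [← lorentzMatrix_transpose_mul Λ]
  simp [Matrix.mul_apply, Fin.sum_univ_four, minkowskiMetric, Matrix.diagonal_apply]
  ring

/-- The proper orthochronous Lorentz group preserves the time orientation. -/
theorem lorentzMatrix_zero_zero_pos (Λ : properLorentz) : 0 < lorentzMatrix Λ 0 0 := by
  let φ : lorentzGroup → ℝ := fun M => ((M : GL (Fin 4) ℝ) : Matrix (Fin 4) (Fin 4) ℝ) 0 0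
  have hφ : Continuous φ := by
    have h : Continuous fun M : lorentzGroup =>
        ((M : GL (Fin 4) ℝ) : Matrix (Fin 4) (Fin 4) ℝ) :=
      Units.continuous_val.comp continuous_subtype_val
    exact h.matrix_elem 0 0
  have hne : ∀ M : lorentzGroup, φ M ≠ 0 := by
    intro M h0
    -- The `(0,0)` entry of the Lorentz relation reads `M₀₀² = 1 + M₁₀² + M₂₀² + M₃₀²`, so `M₀₀`
    -- cannot change sign on a connected set.
    have h := congrFun (congrFun M.2 0) 0
    simp [Matrix.mul_apply, Fin.sum_univ_four, minkowskiMetric, Matrix.diagonal_apply] at h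
    change ((M : GL (Fin 4) ℝ) : Matrix (Fin 4) (Fin 4) ℝ) 0 0 = 0 at h0
    rw [h0] at h
    nlinarith [sq_nonneg (((M : GL (Fin 4) ℝ) : Matrix (Fin 4) (Fin 4) ℝ) 1 0),
      sq_nonneg (((M : GL (Fin 4) ℝ) : Matrix (Fin 4) (Fin 4) ℝ) 2 0),
      sq_nonneg (((M : GL (Fin 4) ℝ) : Matrix (Fin 4) (Fin 4) ℝ) 3 0)]
  have hconn : IsPreconnected (connectedComponent (1 : lorentzGroup)) :=
    isPreconnected_connectedComponent
  have hΛ : (Λ : lorentzGroup) ∈ connectedComponent (1 : lorentzGroup) := Λ.2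
  by_contra! hle
  have h1 : φ 1 = 1 := by simp [φ]
  obtain ⟨M, -, hM⟩ := hconn.intermediate_value hΛ mem_connectedComponent hφ.continuousOn
    (show (0 : ℝ) ∈ Set.Icc (φ Λ) (φ 1) from ⟨hle, by rw [h1]; norm_num⟩)
  exact hne M hM

theorem eq_zero_of_forall_affine_pos {m c : ℝ} (h : ∀ s : ℝ, 0 < s * m + c) : m = 0 := by
  by_contra hm
  have := h (-c / m)
  rw [div_mul_cancel₀ _ hm] at this
  linarith

theorem nonneg_of_forall_affine_pos {m c : ℝ} (h : ∀ s : ℝ, 0 < s → 0 < s * m + c) :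
    0 ≤ m ∧ 0 ≤ c := by
  constructor
  · by_contra! hm
    have h1 := h ((|c| + 1) / -m) (by have : 0 < -m := by linarith
                                      positivity)
    have : (|c| + 1) / -m * m = -(|c| + 1) := by
      have := hm.ne
      field_simp
    rw [this] at h1
    linarith [le_abs_self c]
  · by_contra! hc
    have h1 := h (-c / (|m| + 1)) (by have : 0 < -c := by linarith
                                      positivity)
    have h2 : -c / (|m| + 1) * m ≤ -c := by
      rw [div_mul_eq_mul_div, div_le_iff₀ (by positivity)]
      nlinarith [le_abs_self m, abs_nonneg m]
    linarith

theorem poincare_smul_apply (g : Poincare) (x : Spacetime) (i : Fin 4) :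
    (g • x) i = lorentzMatrix g.right i 0 * x 0 + lorentzMatrix g.right i 1 * x 1
      + lorentzMatrix g.right i 2 * x 2 + lorentzMatrix g.right i 3 * x 3 + g.left.toAdd i := by
  rw [poincare_smul_def, Pi.add_apply, Matrix.mulVec, dotProduct, Fin.sum_univ_four]

/-- The part of the stabilizer conditions of the right wedge that only uses one inclusion. -/
theorem stabilizer_entries {g : Poincare} (hg : ∀ x ∈ rightWedge, g • x ∈ rightWedge) :
    (∀ j : Fin 4, j = 2 ∨ j = 3 →
      lorentzMatrix g.right 0 j = 0 ∧ lorentzMatrix g.right 1 j = 0) ∧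
    0 ≤ lorentzMatrix g.right 1 1 ∧ |g.left.toAdd 0| ≤ g.left.toAdd 1 := by
  set M := lorentzMatrix g.right with hM
  set a : Spacetime := g.left.toAdd with ha
  have hx : ∀ x ∈ rightWedge, -(g • x) 1 < (g • x) 0 ∧ (g • x) 0 < (g • x) 1 :=
    fun x h => abs_lt.1 (hg x h)
  simp only [poincare_smul_apply, ← hM, ← ha] at hx
  -- The points `(0, 1, s, s')` lie in the wedge for all real `s, s'`; the forms `x₁ ± x₀` of their
  -- images stay positive, so they cannot depend on `s` or `s'`.
  have hcol : ∀ j : Fin 4, j = 2 ∨ j = 3 → M 1 j + M 0 j = 0 ∧ M 1 j - M 0 j = 0 := by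
    have hmem : ∀ s s' : ℝ, (![0, 1, s, s'] : Spacetime) ∈ rightWedge := by
      intro s s'; simp [rightWedge]
    rintro j (rfl | rfl)
    · constructor
      · refine eq_zero_of_forall_affine_pos (c := M 1 1 + M 0 1 + a 1 + a 0) fun s => ?_
        have := hx _ (hmem s 0)
        simp at this
        linarith
      · refine eq_zero_of_forall_affine_pos (c := M 1 1 - M 0 1 + a 1 - a 0) fun s => ?_
        have := hx _ (hmem s 0)
        simp at this
        linarith
    · constructor
      · refine eq_zero_of_forall_affine_pos (c := M 1 1 + M 0 1 + a 1 + a 0) fun s => ?_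
        have := hx _ (hmem 0 s)
        simp at this
        linarith
      · refine eq_zero_of_forall_affine_pos (c := M 1 1 - M 0 1 + a 1 - a 0) fun s => ?_
        have := hx _ (hmem 0 s)
        simp at this
        linarith
  -- Along this half-line, large `s` tests the linear part and small `s` the translation.
  have hmem : ∀ s : ℝ, 0 < s → (![0, s, 0, 0] : Spacetime) ∈ rightWedge := by
    intro s hs; simpa [rightWedge] using hs
  obtain ⟨h1, h2⟩ := nonneg_of_forall_affine_pos (m := M 1 1 + M 0 1) (c := a 1 + a 0)
    fun s hs => by
      have := hx _ (hmem s hs)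
      simp at this
      linarith
  obtain ⟨h3, h4⟩ := nonneg_of_forall_affine_pos (m := M 1 1 - M 0 1) (c := a 1 - a 0)
    fun s hs => by
      have := hx _ (hmem s hs)
      simp at this
      linarith
  refine ⟨fun j hj => ?_, by linarith, abs_le.2 ⟨by linarith, by linarith⟩⟩
  obtain ⟨h5, h6⟩ := hcol j hj
  constructor <;> linarith

theorem lorentzMatrix_injective : Function.Injective lorentzMatrix := by
  intro A B h
  exact Subtype.ext (Subtype.ext (Units.ext h))

/-- The stabilizer of the right wedge commutes with the boosts. -/
theorem commute_boost_of_stabilizer {g : Poincare} (hg : g • rightWedge = rightWedge) (t : ℝ) :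
    Commute g (lorentz (boost t)) := by
  have hmaps : ∀ {g : Poincare}, g • rightWedge = rightWedge →
      ∀ x ∈ rightWedge, g • x ∈ rightWedge :=
    fun h x hx => h ▸ Set.smul_mem_smul_set hx
  obtain ⟨hc, h11, ha⟩ := stabilizer_entries (hmaps hg)
  have hg' : g⁻¹ • rightWedge = rightWedge := by
    conv_lhs => rw [← hg]
    rw [inv_smul_smul]
  obtain ⟨hc', -, ha'⟩ := stabilizer_entries (hmaps hg')
  have hpos := lorentzMatrix_zero_zero_pos g.right
  have hinv := lorentzMatrix_inv_apply g.right
  have hprod := lorentzMatrix_column_product g.right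
  have hleft : ∀ i, g⁻¹.left.toAdd i =
      (lorentzMatrix g.right⁻¹ *ᵥ (-g.left.toAdd : Spacetime)) i := fun i => rfl
  rw [hleft, hleft] at ha'
  simp only [SemidirectProduct.inv_right, hinv] at hc'
  set M := lorentzMatrix g.right with hM
  set a : Spacetime := g.left.toAdd with hadef
  have h02 := (hc 2 (Or.inl rfl)).1
  have h12 := (hc 2 (Or.inl rfl)).2
  have h03 := (hc 3 (Or.inr rfl)).1
  have h13 := (hc 3 (Or.inr rfl)).2
  -- Up to signs the inverse Lorentz matrix is the transpose, so the conditions on `g⁻¹` kill the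
  -- other off-diagonal block of `M`.
  have h20 : M 2 0 = 0 := by simpa using (hc' 2 (Or.inl rfl)).1
  have h21 : M 2 1 = 0 := by simpa using (hc' 2 (Or.inl rfl)).2
  have h30 : M 3 0 = 0 := by simpa using (hc' 3 (Or.inr rfl)).1
  have h31 : M 3 1 = 0 := by simpa using (hc' 3 (Or.inr rfl)).2
  have e00 := hprod 0 0
  have e01 := hprod 0 1
  have e11 := hprod 1 1
  simp [minkowskiMetric, h20, h21, h30, h31] at e00 e01 e11
  -- The Lorentz relations determine the upper block up to signs; `M₁₁ ≥ 0` and `M₀₀ > 0` fix these,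
  -- leaving a symmetric block with equal diagonal, which commutes with boosts.
  have hsq : M 0 1 ^ 2 = M 1 0 ^ 2 := by
    have : (M 0 0 * M 0 1) ^ 2 = (M 1 0 * M 1 1) ^ 2 := by rw [sub_eq_zero.1 e01]
    linear_combination this - M 0 1 ^ 2 * e00 - M 1 0 ^ 2 * e11
  have hdiag : M 1 1 = M 0 0 := by
    refine (sq_eq_sq₀ h11 hpos.le).1 ?_
    linear_combination -e11 - e00 + hsq
  have hoff : M 0 1 = M 1 0 := by
    rw [hdiag] at e01
    have : M 0 0 * (M 0 1 - M 1 0) = 0 := by linear_combination e01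
    rcases mul_eq_zero.1 this with h | h
    · exact absurd h hpos.ne'
    · linarith
  -- Both `a` and the translation `-M⁻¹a` of `g⁻¹` lie in the closed wedge. Since `|M₁₀| < M₀₀`,
  -- this forces `a₁ = 0`, and then `a₀ = 0`.
  have hzero : a 0 = 0 ∧ a 1 = 0 := by
    rw [Matrix.mulVec, Matrix.mulVec, dotProduct, dotProduct, Fin.sum_univ_four,
      Fin.sum_univ_four] at ha'
    simp only [hinv] at ha'
    simp [h20, h21, h30, h31, hdiag, hoff] at ha'
    have h1 : M 0 0 * a 1 ≤ M 1 0 * a 0 := by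
      linarith [abs_nonneg (-(M 0 0 * a 0) + M 1 0 * a 1)]
    have h2 := abs_le.1 ha
    have h3 : a 1 = 0 := by
      by_contra hne
      have hp : 0 < a 1 := lt_of_le_of_ne ((abs_nonneg _).trans ha) (Ne.symm hne)
      have h4 : |M 1 0| < M 0 0 := by
        refine abs_lt_of_sq_lt_sq ?_ hpos.le
        nlinarith
      have h5 : M 1 0 * a 0 ≤ |M 1 0| * a 1 := by
        calc _ ≤ |M 1 0 * a 0| := le_abs_self _
          _ = |M 1 0| * |a 0| := abs_mul _ _
          _ ≤ _ := by gcongr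
      nlinarith
    exact ⟨by rw [h3] at h2; linarith [h2.1, h2.2], h3⟩
  refine SemidirectProduct.ext ?_ ?_
  · change a + M *ᵥ (0 : Spacetime) = (0 : Spacetime) + boostMatrix t *ᵥ a
    ext i
    fin_cases i <;> simp [boostMatrix, dotProduct, Fin.sum_univ_four, hzero.1, hzero.2]
  · apply lorentzMatrix_injective
    change M * boostMatrix t = boostMatrix t * M
    ext i j
    fin_cases i <;> fin_cases j <;>
      simp [boostMatrix, Matrix.mul_apply, Fin.sum_univ_four, h20, h21, h30, h31, h02, h12, h03,
        h13, hdiag, hoff] <;> ring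

theorem boostMatrix_add (s t : ℝ) : boostMatrix (s + t) = boostMatrix s * boostMatrix t := by
  ext i j
  fin_cases i <;> fin_cases j <;>
    simp [boostMatrix, Matrix.mul_apply, Fin.sum_univ_four, Real.cosh_add, Real.sinh_add] <;> ring

theorem lorentz_mul (A B : properLorentz) : lorentz (A * B) = lorentz A * lorentz B := by
  refine SemidirectProduct.ext ?_ rfl
  change (0 : Spacetime) = 0 + lorentzMatrix A *ᵥ (0 : Spacetime)
  simp

theorem lorentz_boost_add (s t : ℝ) :
    lorentz (boost (s + t)) = lorentz (boost s) * lorentz (boost t) := by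
  rw [← lorentz_mul]
  congr 1
  exact lorentzMatrix_injective (boostMatrix_add s t)

theorem lorentz_boost_zero : lorentz (boost 0) = 1 := by
  have : boost 0 = 1 := lorentzMatrix_injective boostMatrix_zero
  rw [this]
  rfl

theorem spaceRotation_pi_mul_boost (t : ℝ) :
    lorentz (spaceRotation Real.pi) * lorentz (boost t) =
      lorentz (boost (-t)) * lorentz (spaceRotation Real.pi) := by
  rw [← lorentz_mul, ← lorentz_mul]
  congr 1
  apply lorentzMatrix_injective
  change rotationMatrix Real.pi * boostMatrix t = boostMatrix (-t) * rotationMatrix Real.pi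
  ext i j
  fin_cases i <;> fin_cases j <;>
    simp [boostMatrix, rotationMatrix, Matrix.mul_apply, Fin.sum_univ_four]

theorem boost_smul_rightWedge (t : ℝ) : lorentz (boost t) • rightWedge = rightWedge := by
  have key : ∀ (t : ℝ), ∀ x ∈ rightWedge, lorentz (boost t) • x ∈ rightWedge := by
    intro t x hx
    obtain ⟨h1, h2⟩ := abs_lt.1 (show |x 0| < x 1 from hx)
    have h3 := Real.sinh_lt_cosh t
    have h4 : -Real.sinh t < Real.cosh t := by simpa using Real.sinh_lt_cosh (-t)
    have e0 : (lorentz (boost t) • x) 0 = Real.cosh t * x 0 + Real.sinh t * x 1 := by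
      rw [poincare_smul_apply]
      change boostMatrix t 0 0 * x 0 + boostMatrix t 0 1 * x 1 + boostMatrix t 0 2 * x 2 +
        boostMatrix t 0 3 * x 3 + 0 = _
      simp [boostMatrix]
    have e1 : (lorentz (boost t) • x) 1 = Real.sinh t * x 0 + Real.cosh t * x 1 := by
      rw [poincare_smul_apply]
      change boostMatrix t 1 0 * x 0 + boostMatrix t 1 1 * x 1 + boostMatrix t 1 2 * x 2 +
        boostMatrix t 1 3 * x 3 + 0 = _
      simp [boostMatrix]
    change |(lorentz (boost t) • x) 0| < (lorentz (boost t) • x) 1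
    rw [e0, e1, abs_lt]
    constructor <;> nlinarith
  refine Set.Subset.antisymm ?_ fun x hx => ?_
  · rintro _ ⟨x, hx, rfl⟩
    exact key t x hx
  · refine ⟨lorentz (boost (-t)) • x, key _ x hx, ?_⟩
    change lorentz (boost t) • lorentz (boost (-t)) • x = x
    rw [smul_smul, ← lorentz_boost_add, add_neg_cancel, lorentz_boost_zero, one_smul]

namespace Wedge

theorem smul_val (g : Poincare) (W : Wedge) : (g • W).1 = g • W.1 := rfl

theorem compl_smul (g : Poincare) (W : Wedge) : (g • W).compl = g • W.compl :=
  Subtype.ext (causalComplement_smul g W.1)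

theorem exists_boosts_eq (W : Wedge) :
    ∃ g : Poincare, W.1 = g • rightWedge ∧ ∀ t, W.boosts t = g * lorentz (boost t) * g⁻¹ :=
  ⟨W.2.choose, W.2.choose_spec, fun _ => rfl⟩

theorem boosts_smul (W : Wedge) (t : ℝ) : W.boosts t • W = W := by
  obtain ⟨g, hg, hb⟩ := W.exists_boosts_eq
  refine Subtype.ext ?_
  rw [smul_val, hb, hg, smul_smul, inv_mul_cancel_right, mul_smul, boost_smul_rightWedge]

theorem boosts_add (W : Wedge) (s t : ℝ) : W.boosts (s + t) = W.boosts s * W.boosts t := by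
  simp only [boosts, lorentz_boost_add]
  group

theorem boosts_zero (W : Wedge) : W.boosts 0 = 1 := by
  simp [boosts, lorentz_boost_zero]

/-- Any two wedges are related by a Poincaré transformation that intertwines their boosts. -/
theorem exists_smul_eq (W V : Wedge) :
    ∃ g : Poincare, g • W = V ∧ ∀ t, V.boosts t * g = g * W.boosts t := by
  obtain ⟨g, hg, hb⟩ := W.exists_boosts_eq
  obtain ⟨h, hh, hb'⟩ := V.exists_boosts_eq
  -- With the very representatives chosen in the definition of `boosts`, the intertwining relation
  -- is pure group algebra.
  refine ⟨h * g⁻¹, Subtype.ext ?_, fun t => ?_⟩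
  · rw [smul_val, hg, hh, smul_smul, inv_mul_cancel_right]
  · rw [hb, hb']
    group

/-- A Poincaré transformation that maps `W` onto `W'` reverses the boosts of `W`. -/
theorem mul_boosts_of_smul_eq_compl {W : Wedge} {r : Poincare} (hr : r • W = W.compl) (t : ℝ) :
    r * W.boosts t = W.boosts (-t) * r := by
  obtain ⟨g, hW, hb⟩ := W.exists_boosts_eq
  rw [hb, hb]
  set ρ := lorentz (spaceRotation Real.pi) with hρ
  have h1 : r • g • rightWedge = g • ρ • rightWedge := by
    have := congrArg Subtype.val hr
    change r • W.1 = causalComplement W.1 at this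
    rw [hW, causalComplement_smul, causalComplement_rightWedge,
      ← spaceRotation_smul_rightWedge] at this
    exact this
  -- Thus `r` is `g ρ g⁻¹` up to a stabilizer element, which commutes with the boosts; the sign
  -- change comes from the rotation `ρ` alone.
  have h2 : (ρ⁻¹ * g⁻¹ * r * g) • rightWedge = rightWedge := by
    rw [mul_smul, mul_smul, h1, mul_smul, inv_smul_smul, inv_smul_smul]
  have h3 := (commute_boost_of_stabilizer h2 t).eq
  have h4 := spaceRotation_pi_mul_boost t
  rw [← hρ] at h4
  set b := lorentz (boost t)
  set b' := lorentz (boost (-t))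
  calc r * (g * b * g⁻¹) = g * ρ * ((ρ⁻¹ * g⁻¹ * r * g) * b) * g⁻¹ := by group
    _ = g * (ρ * b) * (ρ⁻¹ * g⁻¹ * r) := by rw [h3]; group
    _ = g * b' * g⁻¹ * r := by rw [h4]; group

end Wedge

end Minkowski

/-! ### From commutation with `Z` to duality and the Bisognano–Wichmann property. -/

noncomputable section Nets

open Complex ClosedSubmodule StandardSubspace

namespace PositiveEnergyRep

variable {H : Type*} [NormedAddCommGroup H] [InnerProductSpace ℂ H] [CompleteSpace H]

theorem op_mul (U : PositiveEnergyRep H) (g h : Poincare) : U.op (g * h) = U.op g * U.op h := by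
  rw [PositiveEnergyRep.op, map_mul]; rfl

theorem op_one (U : PositiveEnergyRep H) : U.op 1 = 1 := by
  rw [PositiveEnergyRep.op, map_one]; rfl

theorem mul_op_cancel (U : PositiveEnergyRep H) {g : Poincare} {A B : H →L[ℂ] H}
    (h : A * U.op g = B * U.op g) : A = B := by
  have hg : U.op g * U.op g⁻¹ = 1 := by rw [← U.op_mul, mul_inv_cancel, U.op_one]
  rw [← mul_one A, ← hg, ← mul_assoc, h, mul_assoc, hg, mul_one]

end PositiveEnergyRep

namespace CovariantNet

variable {H : Type*} [NormedAddCommGroup H] [InnerProductSpace ℂ H] [CompleteSpace H]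
  {U : PositiveEnergyRep H}

theorem mapsOnto (N : CovariantNet U) (g : Poincare) {V V' : Wedge} (h : g • V = V') :
    MapsOnto (U.toHom g) (N.standard V) (N.standard V') := by
  subst h
  exact N.covariance V g

theorem modularGroup_mul_op (N : CovariantNet U) (g : Poincare) {V V' : Wedge} (h : g • V = V')
    (t : ℝ) : (N.standard V').modularGroup t * U.op g = U.op g * (N.standard V).modularGroup t :=
  (N.mapsOnto g h).modularGroup t

/-- If `Z_{H(W)}` commutes with `U(r)`, then `Δ_{H(W)}^{it} U(Λ_W(4πt)) = Δ_{H(W')}^{it}`. -/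
theorem modularGroup_compl (N : CovariantNet U) {W : Wedge} {r : Poincare}
    (hr : r • W = W.compl) (hZ : ∀ t : ℝ, Commute (N.Z W t) (U.op r)) (t : ℝ) :
    (N.standard W).modularGroup t * U.op (W.boosts (2 * (2 * Real.pi * t))) =
      (N.standard W.compl).modularGroup t := by
  set b := W.boosts (2 * Real.pi * t) with hb
  have h1 := (hZ t).eq
  have h2 : r * b = W.boosts (-(2 * Real.pi * t)) * r := Wedge.mul_boosts_of_smul_eq_compl hr _
  have h3 : W.boosts (-(2 * Real.pi * t)) * b = 1 := by
    rw [hb, ← Wedge.boosts_add, neg_add_cancel, Wedge.boosts_zero]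
  -- The right side is `U(r) Z(t) U(r)⁻¹`: covariance replaces `W` by `W'` in the modular group, and
  -- `r` reverses the boost.
  have h4 : (N.standard W).modularGroup t * U.op b =
      (N.standard W.compl).modularGroup t * U.op (W.boosts (-(2 * Real.pi * t))) := by
    refine U.mul_op_cancel (g := r) ?_
    rw [Z, ← hb] at h1
    rw [h1, ← mul_assoc, ← N.modularGroup_mul_op r hr, mul_assoc, mul_assoc, ← U.op_mul,
      ← U.op_mul, h2]
  rw [two_mul, Wedge.boosts_add, ← hb, U.op_mul, ← mul_assoc, h4, mul_assoc, ← U.op_mul, h3,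
    U.op_one, mul_one]

/-- Locality gives one inclusion. Equality follows by rigidity, since the modular group of `H(W)'`
factors into the modular group of `H(W')` and boosts, each of which preserves `H(W')`. -/
theorem standard_compl (N : CovariantNet U) {W : Wedge} {r : Poincare}
    (hr : r • W = W.compl) (hZ : ∀ t : ℝ, Commute (N.Z W t) (U.op r)) :
    N.standard W.compl = (N.standard W).symplComp := by
  refine eq_of_le_of_modularGroup_invariant (N.locality _ _ subset_rfl) fun t x => ?_
  have hb : ∀ s x, (N.standard W.compl).proj (U.op (W.boosts s) x) =
      U.op (W.boosts s) ((N.standard W.compl).proj x) := fun s x =>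
    (N.mapsOnto (W.boosts s) (by rw [← Wedge.compl_smul, Wedge.boosts_smul])).proj x
  have h1 : (N.standard W).modularGroup (-t) = (N.standard W.compl).modularGroup (-t) *
      U.op (W.boosts (2 * (2 * Real.pi * t))) := by
    rw [← N.modularGroup_compl hr hZ, mul_assoc, ← U.op_mul, ← Wedge.boosts_add]
    rw [show 2 * (2 * Real.pi * -t) + 2 * (2 * Real.pi * t) = 0 by ring, Wedge.boosts_zero,
      U.op_one, mul_one]
  rw [modularGroup_symplComp, h1]
  simp only [mul_apply_eq_comp]
  rw [proj_modularGroup, hb]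

/-- After duality, `modularGroup_compl` at `t/2` reads `Δ^{it/2} U(Λ_W(2πt)) = Δ^{-it/2}`. -/
theorem op_boosts_eq (N : CovariantNet U) {W : Wedge} {r : Poincare}
    (hr : r • W = W.compl) (hZ : ∀ t : ℝ, Commute (N.Z W t) (U.op r)) (t : ℝ) :
    U.op (W.boosts (2 * Real.pi * t)) = (N.standard W).modularGroup (-t) := by
  have h := N.modularGroup_compl hr hZ (t / 2)
  rw [N.standard_compl hr hZ, modularGroup_symplComp,
    show 2 * (2 * Real.pi * (t / 2)) = 2 * Real.pi * t by ring] at h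
  calc _ = (N.standard W).modularGroup (-(t / 2)) * ((N.standard W).modularGroup (t / 2) *
        U.op (W.boosts (2 * Real.pi * t))) := by rw [← mul_assoc, modularGroup_neg_mul, one_mul]
    _ = _ := by rw [h, ← modularGroup_add]; congr 1; ring

end CovariantNet

end Nets

theorem theorem3p1 {H : Type*} [NormedAddCommGroup H] [InnerProductSpace ℂ H] [CompleteSpace H]
    (U : PositiveEnergyRep H) (N : CovariantNet U) (W : Wedge) (r : Poincare)
    (hr : r • W = W.compl) (hZ : ∀ t : ℝ, Commute (N.Z W t) (U.op r)) :
    N.BisognanoWichmann ∧ N.WedgeDuality := by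
  refine ⟨fun V t => ?_, fun V => ?_⟩
  · obtain ⟨g, hg, hb⟩ := Wedge.exists_smul_eq W V
    refine U.mul_op_cancel (g := g) ?_
    rw [← U.op_mul, hb, U.op_mul, N.op_boosts_eq hr hZ,
      N.modularGroup_mul_op g hg]
  · obtain ⟨g, hg, -⟩ := Wedge.exists_smul_eq W V
    have h1 := N.mapsOnto g (show g • W.compl = V.compl by rw [← hg, Wedge.compl_smul])
    have h2 := (N.mapsOnto g hg).symplComp
    rw [← N.standard_compl hr hZ] at h2
    have h3 : N.standard V.compl = (N.standard V).symplComp :=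
      StandardSubspace.toClosedSubmodule_inj.1 (SetLike.coe_injective (h1.symm.trans h2))
    -- Transport yields `H(V') = H(V)'`; a second complement gives the stated form, as `H(V)'' =
    -- H(V)`.
    have h4 := congrArg StandardSubspace.symplComp h3
    rw [StandardSubspace.symplComp_symplComp_eq] at h4
    exact (congrArg StandardSubspace.toClosedSubmodule h4).symm
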